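/- Let $\Gamma\subset\mathbb C$ be a lattice, i.e. a discrete additive subgroup of $\mathbb C$ of rank $2$. For a discrete additive subgroup $G\subset\mathbb C$ put $$\wp(z;G)=\frac1{z^2}+\sum_{u\in G\setminus\{0\}}\Big(\frac1{(z-u)^2}-\frac1{u^2}\Big),\quad g_2(G)=\sum_{u\in G\setminus\{0\}}\frac{60}{u^4},\quad g_3(G)=\sum_{u\in G\setminus\{0\}}\frac{140}{u^6},$$ and $\Delta(G)=g_2(G)^3-27g_3(G)^2$. A subgroup $\Gamma'$ of index $2$ in $\Gamma$ is called optimal if $|\Delta(\Gamma')|\le|\Delta(G)|$ for all subgroups $G\subset\Gamma$ of index $2$. Let $\Gamma'$ be a subgroup of index $2$ in $\Gamma$. Then the following statements hold. (i) Let $\omega\in\Gamma'\setminus2\Gamma$, and let $e_1,e_2,e_3$ be the three roots of the polynomial $4x^3-g_2(\Gamma)x-g_3(\Gamma)$, numbered so that $e_1=\wp(\omega/2;\Gamma)$. Then $\Gamma'$ is optimal if and only if $|e_2-e_3|\le\min\{|e_1-e_2|,|e_1-e_3|\}$. (ii) $\Gamma'$ is optimal if and only if there is $\omega\in\Gamma$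 such that $\omega\in\Gamma'$ and $|\omega|=\inf\{|w|:w\in\Gamma\setminus\{0\}\}$. -/

import Mathlib

namespace LandenLattice

noncomputable section

/-- A lattice in `ℂ`: a discrete additive subgroup of rank exactly two. -/
structure IsLattice (Γ : AddSubgroup ℂ) : Prop where
  discrete : DiscreteTopology Γ
  rank_eq_two : Module.finrank ℤ Γ = 2

/-- The Weierstrass function
`℘(z; Γ) = 1 / z² + ∑_{u ∈ Γ \ {0}} (1 / (z - u)² - 1 / u²)`. -/
def wp (Γ : AddSubgroup ℂ) (z : ℂ) : ℂ :=
  1 / z ^ 2 + ∑' u : {u : ℂ // u ∈ Γ ∧ u ≠ 0}, (1 / (z - u) ^ 2 - 1 / (u : ℂ) ^ 2)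

/-- The invariant `g₂(Γ) = ∑_{u ∈ Γ \ {0}} 60 / u⁴`. -/
def g₂ (Γ : AddSubgroup ℂ) : ℂ :=
  ∑' u : {u : ℂ // u ∈ Γ ∧ u ≠ 0}, 60 / (u : ℂ) ^ 4

/-- The invariant `g₃(Γ) = ∑_{u ∈ Γ \ {0}} 140 / u⁶`. -/
def g₃ (Γ : AddSubgroup ℂ) : ℂ :=
  ∑' u : {u : ℂ // u ∈ Γ ∧ u ≠ 0}, 140 / (u : ℂ) ^ 6

/-- The discriminant `Δ(Γ) = g₂(Γ)³ - 27 g₃(Γ)²`. -/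
def discr (Γ : AddSubgroup ℂ) : ℂ :=
  g₂ Γ ^ 3 - 27 * g₃ Γ ^ 2

/-- The polynomial `4 x³ - g₂(Γ) x - g₃(Γ)`. -/
def cubic (Γ : AddSubgroup ℂ) : Polynomial ℂ :=
  Polynomial.C 4 * Polynomial.X ^ 3 - Polynomial.C (g₂ Γ) * Polynomial.X - Polynomial.C (g₃ Γ)

/-- `G` is a subgroup of index two in `Γ`. -/
def IsIndexTwo (G Γ : AddSubgroup ℂ) : Prop :=
  G ≤ Γ ∧ G.relIndex Γ = 2

/-- `Γ'` is an optimal subgroup of index two in `Γ`: it minimizes `|Δ|` among all subgroups of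
index two in `Γ`. -/
def IsOptimal (Γ' Γ : AddSubgroup ℂ) : Prop :=
  IsIndexTwo Γ' Γ ∧ ∀ G : AddSubgroup ℂ, IsIndexTwo G Γ → ‖discr Γ'‖ ≤ ‖discr G‖

end

end LandenLattice

/-! ### Estimates for the Euler product ∏ (1 − qⁿ). -/

namespace LandenLattice

open Complex Filter Topology

/-! Choose a basis (ω, ωτ) of Γ with τ in the standard fundamental domain. The subgroups of index
two are Γ₁ = ⟨ω, 2ωτ⟩, Γ₂ = ⟨2ω, ωτ⟩ and Γ₃ = ⟨2ω, ω + ωτ⟩, so optimality compares three numbers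
(`isOptimal_iff`).

For (i), let E₁, E₂, E₃ be the values of ℘ at ω/2, ωτ/2, (ω + ωτ)/2. Splitting lattice sums into
cosets expresses g₂ and g₃ of Γᵢ through derivatives of ℘ at the half period, hence Δ(Γᵢ) through Eᵢ
and g₂(Γ) (`discr_of_half_period`). The relations between roots and coefficients turn this into
|Δ(Γ₁)|² = K|E₂ − E₃|⁶ and its permutations, with one K > 0 (`norm_discr_subpair_sq`); (i) follows
at once.

For (ii), put p = exp(πiτ). Up to a common factor the three |Δ(Γᵢ)| are 2¹²|η(2τ)|²⁴, |η(τ/2)|²⁴ and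
|η((τ+1)/2)|²⁴, which are Euler products in p⁴, p and −p. They are increasing in this order. The
first two agree exactly when |τ| = 1: inversion and complex conjugation give equality on the unit
circle, and radial monotonicity in p gives strictness above it (`norm_eta_lt_of_one_lt_norm`). The
last two agree exactly when |Re τ| = 1/2, that is, Re p = 0 (`norm_eta_half_le`,
`norm_eta_half_add_eq`). Now ω is a shortest vector and lies in Γ₁, while Γ₂ contains a vector of
that length iff |τ| = 1, and Γ₃ iff |τ| = 1 and |Re τ| = 1/2. These are the same conditions. -/

/-- The norm of the Euler product `∏ (1 - qⁿ)`. -/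
noncomputable def eulerNorm (q : ℂ) : ℝ := ‖∏' n : ℕ, (1 - q ^ (n + 1))‖

lemma tendsto_eulerNorm {q : ℂ} (hq : ‖q‖ < 1) :
    Tendsto (fun N ↦ ∏ n ∈ Finset.range N, ‖1 - q ^ (n + 1)‖) atTop (𝓝 (eulerNorm q)) := by
  have := (ModularForm.multipliable_one_sub_pow hq).hasProd.tendsto_prod_nat.norm
  simpa [norm_prod, eulerNorm] using this

lemma eulerNorm_conj (q : ℂ) (hq : ‖q‖ < 1) :
    eulerNorm (starRingEnd ℂ q) = eulerNorm q := by
  refine tendsto_nhds_unique (tendsto_eulerNorm (by simpa using hq)) ?_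
  convert tendsto_eulerNorm hq using 3 with N n
  rw [← Complex.norm_conj]
  simp

lemma eulerNorm_pos {q : ℂ} (hq : ‖q‖ < 1) : 0 < eulerNorm q := by
  rw [eulerNorm, norm_pos_iff]
  have := tprod_one_add_ne_zero_of_summable (f := fun n : ℕ ↦ -q ^ (n + 1)) ?_ ?_
  · simpa [sub_eq_add_neg] using this
  · intro n h
    have h1 : q ^ (n + 1) = 1 := by linear_combination -h
    have := congrArg norm h1
    rw [norm_pow, norm_one] at this
    exact (pow_lt_one₀ (norm_nonneg q) hq (by simp)).ne this
  · simpa using (summable_nat_add_iff 1).mpr (summable_geometric_of_lt_one (norm_nonneg q) hq)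

/-- The two numbers differ by (1 − t)‖z‖ and both have norm at least 11/12, so the relative change
is at most c(1 − t) with c = (12/11)‖z‖. Bernoulli's inequality for exponents c ≤ 1 turns this into
a power of t, a form that multiplies well over the factors of the product. -/
lemma norm_one_sub_mul_rpow_le {z : ℂ} (hz : ‖z‖ ≤ 1 / 12) {t : ℝ} (ht : 0 < t) (ht1 : t ≤ 1) :
    ‖1 - z‖ * t ^ (12 / 11 * ‖z‖) ≤ ‖1 - t * z‖ ∧
      ‖1 - t * z‖ * t ^ (12 / 11 * ‖z‖) ≤ ‖1 - z‖ := by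
  set c := 12 / 11 * ‖z‖ with hc
  have hz0 := norm_nonneg z
  have hb : t ^ c ≤ 1 + c * (t - 1) := by
    simpa using rpow_one_add_le_one_add_mul_self (s := t - 1) (by linarith) (p := c)
      (by positivity) (by linarith)
  have htz : ‖(t : ℂ) * z‖ ≤ 1 / 12 := by
    rw [norm_mul, norm_real, Real.norm_of_nonneg ht.le]; nlinarith
  have hdiff : ‖((1 - t : ℝ) : ℂ) * z‖ = (1 - t) * ‖z‖ := by
    rw [norm_mul, norm_real, Real.norm_of_nonneg (by linarith)]
  have key : ∀ x y : ℂ, 11 / 12 ≤ ‖x‖ → ‖x - y‖ = (1 - t) * ‖z‖ → ‖x‖ * t ^ c ≤ ‖y‖ := by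
    intro x y hx hxy
    have h1 : ‖x‖ - ‖y‖ ≤ (1 - t) * ‖z‖ := hxy ▸ norm_sub_norm_le x y
    have h2 : ‖x‖ * t ^ c ≤ ‖x‖ * (1 + c * (t - 1)) := by gcongr
    have h3 : 0 ≤ (1 - t) * ‖z‖ := mul_nonneg (by linarith) hz0
    have h4 : (‖x‖ - 11 / 12) * ((1 - t) * ‖z‖) ≥ 0 := mul_nonneg (by linarith) h3
    rw [hc] at h2 ⊢
    nlinarith
  have low : ∀ w : ℂ, ‖w‖ ≤ 1 / 12 → 11 / 12 ≤ ‖1 - w‖ := fun w hw ↦ by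
    have := norm_sub_norm_le (1 : ℂ) w
    rw [norm_one] at this
    linarith
  refine ⟨key _ _ (low _ hz) ?_, key _ _ (low _ htz) ?_⟩
  · rw [← hdiff, ← norm_neg]; congr 1; push_cast; ring
  · rw [← hdiff]; congr 1; push_cast; ring

lemma sum_mul_pow_le {r : ℝ} (h0 : 0 ≤ r) (h1 : r ≤ 1 / 12) (N : ℕ) :
    ∑ n ∈ Finset.range N, ((n : ℝ) + 1) * r ^ (n + 1) ≤ 144 / 121 * r := by
  have hs := hasSum_coe_mul_geometric_of_norm_lt_one (r := r)
    (by rw [Real.norm_of_nonneg h0]; linarith)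
  have h2 : ∑ n ∈ Finset.range N, ((n : ℝ) + 1) * r ^ (n + 1) ≤ r / (1 - r) ^ 2 := by
    have := sum_le_hasSum (Finset.range (N + 1)) (fun n _ ↦ by positivity) hs
    rw [Finset.sum_range_succ'] at this
    simpa using this
  refine h2.trans ?_
  rw [div_le_iff₀ (by nlinarith)]
  nlinarith [mul_nonneg h0 (sub_nonneg.2 h1), mul_nonneg (mul_nonneg h0 (sub_nonneg.2 h1)) h0]

/-- The previous bound is applied to each factor with z = qⁿ, t = sⁿ. The exponents add up to
(12/11) ∑ n‖q‖ⁿ ≤ (12/11)³‖q‖, and (12/11)³ < 13/10. -/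
lemma eulerNorm_mul_rpow_le {q : ℂ} (hq : ‖q‖ ≤ 1 / 12) {s : ℝ} (hs : 0 < s) (hs1 : s ≤ 1) :
    eulerNorm q * s ^ (13 / 10 * ‖q‖) ≤ eulerNorm (s * q) ∧
      eulerNorm (s * q) * s ^ (13 / 10 * ‖q‖) ≤ eulerNorm q := by
  have hsq : ‖(s : ℂ) * q‖ < 1 := by
    rw [norm_mul, norm_real, Real.norm_of_nonneg hs.le]
    nlinarith [norm_nonneg q]
  have hq1 : ‖q‖ < 1 := by linarith
  have hexp : ∀ N : ℕ, s ^ (13 / 10 * ‖q‖) ≤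
      ∏ n ∈ Finset.range N, (s ^ (n + 1)) ^ (12 / 11 * ‖q ^ (n + 1)‖) := by
    intro N
    have : ∀ n : ℕ, (s ^ (n + 1)) ^ (12 / 11 * ‖q ^ (n + 1)‖) =
        s ^ (12 / 11 * (((n : ℝ) + 1) * ‖q‖ ^ (n + 1))) := by
      intro n
      rw [← Real.rpow_natCast, ← Real.rpow_mul hs.le, norm_pow]
      congr 1
      push_cast
      ring
    simp_rw [this]
    rw [← Real.rpow_sum_of_pos hs, ← Finset.mul_sum]
    refine Real.rpow_le_rpow_of_exponent_ge hs hs1 ?_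
    nlinarith [sum_mul_pow_le (norm_nonneg q) hq N, norm_nonneg q]
  have hpow : ∀ n : ℕ, ‖q ^ (n + 1)‖ ≤ 1 / 12 := fun n ↦ by
    rw [norm_pow, pow_succ]
    have := pow_le_one₀ (n := n) (norm_nonneg q) hq1.le
    nlinarith [norm_nonneg q]
  have hterm := fun n : ℕ ↦ norm_one_sub_mul_rpow_le (hpow n) (pow_pos hs (n + 1))
    (pow_le_one₀ hs.le hs1)
  have e : ∀ n : ℕ, ((s ^ (n + 1) : ℝ) : ℂ) * q ^ (n + 1) = (s * q) ^ (n + 1) := fun n ↦ by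
    push_cast; ring
  simp_rw [e] at hterm
  constructor
  · refine le_of_tendsto_of_tendsto' ((tendsto_eulerNorm hq1).mul_const _) (tendsto_eulerNorm hsq)
      fun N ↦ ?_
    refine (mul_le_mul_of_nonneg_left (hexp N) (by positivity)).trans ?_
    rw [← Finset.prod_mul_distrib]
    exact Finset.prod_le_prod (fun n _ ↦ by positivity) fun n _ ↦ (hterm n).1
  · refine le_of_tendsto_of_tendsto' ((tendsto_eulerNorm hsq).mul_const _) (tendsto_eulerNorm hq1)
      fun N ↦ ?_
    refine (mul_le_mul_of_nonneg_left (hexp N) (by positivity)).trans ?_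
    rw [← Finset.prod_mul_distrib]
    exact Finset.prod_le_prod (fun n _ ↦ by positivity) fun n _ ↦ (hterm n).2

/-- Radial monotonicity of `p ∏ ((1 - p⁴ⁿ) / (1 - pⁿ))⁸`. -/
lemma norm_mul_eulerNorm_lt {p : ℂ} (hp0 : p ≠ 0) (hp : ‖p‖ ≤ 1 / 12) {s : ℝ} (hs : 0 < s)
    (hs1 : s < 1) :
    ‖s * p‖ * eulerNorm ((s * p) ^ 4) ^ 8 * eulerNorm p ^ 8 <
      ‖p‖ * eulerNorm (p ^ 4) ^ 8 * eulerNorm (s * p) ^ 8 := by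
  have hn := norm_pos_iff.2 hp0
  have hp4 : ‖p ^ 4‖ ≤ 1 / 20000 := by
    rw [norm_pow]
    calc ‖p‖ ^ 4 ≤ (1 / 12) ^ 4 := by gcongr
      _ ≤ _ := by norm_num
  have h1 := (eulerNorm_mul_rpow_le hp hs hs1.le).1
  have h2 := (eulerNorm_mul_rpow_le (q := p ^ 4) (by linarith) (pow_pos hs 4)
    (pow_le_one₀ hs.le hs1.le)).2
  have e4 : ((s ^ 4 : ℝ) : ℂ) * p ^ 4 = (s * p) ^ 4 := by push_cast; ring
  rw [e4] at h2
  set a := s ^ (13 / 10 * ‖p‖) with ha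
  set b := (s ^ 4) ^ (13 / 10 * ‖p ^ 4‖) with hb
  -- The total exponent of s is at most 10.4/12 + 41.6/20000 < 1, so the gain s from the leading
  -- factor beats every loss in the products.
  have hab : s < a ^ 8 * b ^ 8 := by
    have : a ^ 8 * b ^ 8 = s ^ (8 * (13 / 10 * ‖p‖) + 32 * (13 / 10 * ‖p ^ 4‖)) := by
      rw [ha, hb, ← Real.rpow_natCast s 4, ← Real.rpow_mul hs.le, ← Real.rpow_mul_natCast hs.le,
        ← Real.rpow_mul_natCast hs.le, ← Real.rpow_add hs]
      congr 1
      push_cast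
      ring
    rw [this]
    nth_rw 1 [← Real.rpow_one s]
    exact Real.rpow_lt_rpow_of_exponent_gt hs hs1 (by linarith)
  have ha0 : 0 < a := Real.rpow_pos_of_pos hs _
  have hb0 : 0 < b := Real.rpow_pos_of_pos (by positivity) _
  have hsp : ‖(s : ℂ) * p‖ = s * ‖p‖ := by rw [norm_mul, norm_real, Real.norm_of_nonneg hs.le]
  have q1 : ‖p‖ < 1 := by linarith
  have q2 : ‖(s : ℂ) * p‖ < 1 := by rw [hsp]; nlinarith
  have q3 : ‖((s : ℂ) * p) ^ 4‖ < 1 := by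
    rw [norm_pow]; exact pow_lt_one₀ (norm_nonneg _) q2 (by norm_num)
  have p1 := eulerNorm_pos q1
  have p2 := eulerNorm_pos q2
  have p3 := eulerNorm_pos q3
  have i1 : (eulerNorm p * a) ^ 8 ≤ eulerNorm (s * p) ^ 8 := by gcongr
  have i2 : (eulerNorm ((s * p) ^ 4) * b) ^ 8 ≤ eulerNorm (p ^ 4) ^ 8 := by gcongr
  rw [hsp]
  calc s * ‖p‖ * eulerNorm ((s * p) ^ 4) ^ 8 * eulerNorm p ^ 8
      < (a ^ 8 * b ^ 8) * ‖p‖ * eulerNorm ((s * p) ^ 4) ^ 8 * eulerNorm p ^ 8 := by gcongr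
    _ = ‖p‖ * (eulerNorm ((s * p) ^ 4) * b) ^ 8 * (eulerNorm p * a) ^ 8 := by ring
    _ ≤ _ := by gcongr

/-- For odd n the power (i Im p)ⁿ is purely imaginary, so it may be subtracted from pⁿ without
changing the real part; the difference has the factor p − i Im p = Re p. -/
lemma abs_re_pow_le (p : ℂ) {n : ℕ} (hn : Odd n) :
    |(p ^ n).re| ≤ n * ‖p‖ ^ (n - 1) * |p.re| := by
  have h1 : ((p.im * I : ℂ) ^ n).re = 0 := by
    obtain ⟨k, rfl⟩ := hn
    rw [pow_succ, pow_mul, mul_pow, I_sq]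
    have : ((p.im : ℂ) ^ 2 * -1) ^ k * (p.im * I) =
      (((p.im ^ 2 * -1) ^ k * p.im : ℝ) : ℂ) * I := by push_cast; ring
    rw [this]
    simp only [re_ofReal_mul, I_re, mul_zero]
  have h2 : (p ^ n).re = (p ^ n - (p.im * I : ℂ) ^ n).re := by rw [sub_re, h1, sub_zero]
  have h3 : p - p.im * I = p.re := by
    apply Complex.ext <;> simp
  have h4 : ‖(p.im * I : ℂ)‖ ≤ ‖p‖ := by simpa using abs_im_le_norm p
  rw [h2, ← (Commute.all p (p.im * I : ℂ)).geom_sum₂_mul, h3]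
  refine (abs_re_le_norm _).trans ?_
  rw [norm_mul, norm_real, Real.norm_eq_abs]
  gcongr
  refine (norm_sum_le _ _).trans ?_
  calc ∑ i ∈ Finset.range n, ‖p ^ i * (p.im * I : ℂ) ^ (n - 1 - i)‖
      ≤ ∑ i ∈ Finset.range n, ‖p‖ ^ (n - 1) := by
        refine Finset.sum_le_sum fun i hi ↦ ?_
        rw [norm_mul, norm_pow, norm_pow]
        calc ‖p‖ ^ i * ‖(p.im * I : ℂ)‖ ^ (n - 1 - i) ≤ ‖p‖ ^ i * ‖p‖ ^ (n - 1 - i) := by gcongr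
          _ = ‖p‖ ^ (n - 1) := by
            rw [← pow_add]; congr 1; have := Finset.mem_range.1 hi; omega
    _ = _ := by simp

lemma sq_norm_one_sub_eq (z : ℂ) : ‖1 - z‖ ^ 2 = ‖1 + z‖ ^ 2 - 4 * z.re := by
  rw [← normSq_eq_norm_sq, ← normSq_eq_norm_sq, normSq_sub, normSq_add]
  simp
  ring

/-- If `Re p ≥ 0` then the Euler product is smaller at `p` than at `-p`. -/
lemma eulerNorm_sq_le {p : ℂ} (hp : ‖p‖ ≤ 1 / 12) (hre : 0 ≤ p.re) :
    eulerNorm p ^ 2 ≤ eulerNorm (-p) ^ 2 * Real.exp (-2 * p.re) := by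
  have hp1 : ‖p‖ < 1 := by linarith
  have hn0 := norm_nonneg p
  -- Even powers agree at p and −p. For an odd power the squared norm changes by 4 Re pⁿ, and
  -- dividing by ‖1 + pⁿ‖² ≥ 4/5 produces the constant 5.
  have hterm : ∀ n : ℕ, ‖1 - p ^ (n + 2)‖ ^ 2 ≤ ‖1 - (-p) ^ (n + 2)‖ ^ 2 *
      Real.exp (5 * (((n : ℝ) + 2) * ‖p‖ ^ (n + 1)) * p.re) := by
    intro n
    have hE := Real.add_one_le_exp (5 * (((n : ℝ) + 2) * ‖p‖ ^ (n + 1)) * p.re)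
    have hx0 : 0 ≤ 5 * (((n : ℝ) + 2) * ‖p‖ ^ (n + 1)) * p.re := by positivity
    rcases Nat.even_or_odd (n + 2) with h | h
    · rw [h.neg_pow]
      nlinarith [sq_nonneg ‖1 - p ^ (n + 2)‖]
    · rw [h.neg_pow, sub_neg_eq_add, sq_norm_one_sub_eq]
      have h1 := abs_re_pow_le p h
      rw [abs_of_nonneg hre] at h1
      simp only [Nat.add_succ_sub_one] at h1
      push_cast at h1
      have h2 : ‖p ^ (n + 2)‖ ≤ 1 / 144 := by
        rw [norm_pow, pow_add]
        have := pow_le_one₀ (n := n) hn0 hp1.le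
        have h3 : ‖p‖ ^ 2 ≤ (1 / 12) ^ 2 := by gcongr
        nlinarith [sq_nonneg ‖p‖]
      have h3 : 143 / 144 ≤ ‖1 + p ^ (n + 2)‖ := by
        have := norm_sub_le_norm_add (1 : ℂ) (p ^ (n + 2))
        rw [norm_one] at this
        linarith
      have h4 : (4 / 5 : ℝ) ≤ ‖1 + p ^ (n + 2)‖ ^ 2 := by nlinarith
      have h5 := neg_le_abs (p ^ (n + 2)).re
      nlinarith
  -- The linear factor carries the gain: its squared norm drops by 4 Re p, and ‖1 + p‖² ≤ 4/3.
  have hfirst : ‖1 - p ^ (0 + 1)‖ ^ 2 ≤ ‖1 - (-p) ^ (0 + 1)‖ ^ 2 * Real.exp (-3 * p.re) := by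
    rw [zero_add, pow_one, pow_one, sub_neg_eq_add, sq_norm_one_sub_eq]
    have hE := Real.add_one_le_exp (-3 * p.re)
    have h3 : ‖1 + p‖ ≤ 13 / 12 := by
      have := norm_add_le (1 : ℂ) p
      rw [norm_one] at this
      linarith
    have h4 : ‖1 + p‖ ^ 2 ≤ 4 / 3 := by nlinarith [norm_nonneg (1 + p)]
    nlinarith [sq_nonneg ‖1 + p‖]
  have hlim1 := ((tendsto_eulerNorm hp1).comp (tendsto_add_atTop_nat 1)).pow 2
  have hlim2 := (((tendsto_eulerNorm (q := -p) (by simpa using hp1)).comp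
    (tendsto_add_atTop_nat 1)).pow 2).mul_const (Real.exp (-2 * p.re))
  refine le_of_tendsto_of_tendsto' hlim1 hlim2 fun N ↦ ?_
  simp only [Function.comp]
  rw [← Finset.prod_pow, ← Finset.prod_pow, Finset.prod_range_succ', Finset.prod_range_succ']
  -- The higher factors lose at most 5 · 2 · (144/121) · (1/12) < 1 times Re p.
  have hsum : -3 * p.re + ∑ n ∈ Finset.range N, 5 * (((n : ℝ) + 2) * ‖p‖ ^ (n + 1)) * p.re ≤
      -2 * p.re := by
    rw [← Finset.sum_mul, ← Finset.mul_sum]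
    have : ∑ n ∈ Finset.range N, ((n : ℝ) + 2) * ‖p‖ ^ (n + 1) ≤
        2 * ∑ n ∈ Finset.range N, ((n : ℝ) + 1) * ‖p‖ ^ (n + 1) := by
      rw [Finset.mul_sum]
      refine Finset.sum_le_sum fun n _ ↦ ?_
      rw [← mul_assoc]
      gcongr
      linarith [n.cast_nonneg (α := ℝ)]
    have h2 := sum_mul_pow_le hn0 hp N
    nlinarith
  calc (∏ n ∈ Finset.range N, ‖1 - p ^ (n + 1 + 1)‖ ^ 2) * ‖1 - p ^ (0 + 1)‖ ^ 2
      ≤ (∏ n ∈ Finset.range N, ‖1 - (-p) ^ (n + 1 + 1)‖ ^ 2 *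
          Real.exp (5 * (((n : ℝ) + 2) * ‖p‖ ^ (n + 1)) * p.re)) *
          (‖1 - (-p) ^ (0 + 1)‖ ^ 2 * Real.exp (-3 * p.re)) := by
        refine mul_le_mul ?_ hfirst (sq_nonneg _)
          (Finset.prod_nonneg fun _ _ ↦ mul_nonneg (sq_nonneg _) (Real.exp_pos _).le)
        exact Finset.prod_le_prod (fun n _ ↦ sq_nonneg _) fun n _ ↦ hterm n
    _ = (∏ n ∈ Finset.range N, ‖1 - (-p) ^ (n + 1 + 1)‖ ^ 2) * ‖1 - (-p) ^ (0 + 1)‖ ^ 2 *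
        Real.exp (-3 * p.re + ∑ n ∈ Finset.range N, 5 * (((n : ℝ) + 2) * ‖p‖ ^ (n + 1)) * p.re) := by
        rw [Finset.prod_mul_distrib, Real.exp_add, Real.exp_sum]
        ring
    _ ≤ _ := by gcongr

end LandenLattice

/-! ### Comparison of |η| at 2τ, τ/2 and (τ + 1)/2. -/

namespace LandenLattice

open Complex Filter Topology ModularForm

lemma norm_eta_pow (z : ℂ) :
    ‖eta z‖ ^ 24 = ‖cexp (2 * Real.pi * I * z)‖ * eulerNorm (cexp (2 * Real.pi * I * z)) ^ 24 := by
  have h : Function.Periodic.qParam 24 z ^ 24 = cexp (2 * Real.pi * I * z) := by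
    rw [Function.Periodic.qParam, ← Complex.exp_nat_mul]
    congr 1
    push_cast
    ring
  have h1 : Function.Periodic.qParam 1 z = cexp (2 * Real.pi * I * z) := by
    simp [Function.Periodic.qParam]
  rw [ModularForm.eta, norm_mul, mul_pow, ← norm_pow, h, eulerNorm]
  simp only [eta_q, h1]

lemma norm_cexp_pi_mul (z : ℂ) : ‖cexp (Real.pi * I * z)‖ = Real.exp (-(Real.pi * z.im)) := by
  rw [norm_exp]
  congr 1
  simp

lemma norm_eta_half_pow (τ : ℂ) :
    ‖eta (τ / 2)‖ ^ 24 =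
      ‖cexp (Real.pi * I * τ)‖ * eulerNorm (cexp (Real.pi * I * τ)) ^ 24 := by
  rw [norm_eta_pow, show 2 * Real.pi * I * (τ / 2) = Real.pi * I * τ by ring]

lemma norm_eta_two_mul_pow (τ : ℂ) :
    ‖eta (2 * τ)‖ ^ 24 =
      ‖cexp (Real.pi * I * τ)‖ ^ 4 * eulerNorm (cexp (Real.pi * I * τ) ^ 4) ^ 24 := by
  rw [norm_eta_pow, ← norm_pow, ← Complex.exp_nat_mul,
    show 2 * Real.pi * I * (2 * τ) = (4 : ℕ) * (Real.pi * I * τ) by push_cast; ring]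

lemma norm_eta_half_add_pow (τ : ℂ) :
    ‖eta ((τ + 1) / 2)‖ ^ 24 =
      ‖cexp (Real.pi * I * τ)‖ * eulerNorm (-cexp (Real.pi * I * τ)) ^ 24 := by
  rw [norm_eta_half_pow, mul_add, mul_one, Complex.exp_add, Complex.exp_pi_mul_I,
    mul_neg_one, norm_neg]

/-- This is the weight 12 invariance of η²⁴ under S, read on norms. -/
lemma norm_eta_neg_inv_pow {z : ℂ} (hz : 0 < z.im) :
    ‖eta (-z⁻¹)‖ ^ 24 = ‖z‖ ^ 12 * ‖eta z‖ ^ 24 := by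
  have h := congrFun discriminant_S_invariant ⟨z, hz⟩
  rw [ModularForm.SL_slash_apply, UpperHalfPlane.modular_S_smul] at h
  have hd := ModularGroup.denom_S ⟨z, hz⟩
  have h2 := congrArg norm h
  simp only [discriminant] at h2
  rw [hd, norm_mul, norm_pow, norm_pow, norm_zpow, zpow_neg] at h2
  have hz0 : ‖z‖ ≠ 0 := norm_ne_zero_iff.2 fun h ↦ by simp [h] at hz
  rw [← h2, show ‖z‖ ^ (12 : ℤ) = ‖z‖ ^ 12 by norm_cast]
  field_simp

/-- On the unit circle −(τ/2)⁻¹ = −2τ̄, and exp(2πi ·) takes conjugate values at −2τ̄ and 2τ, so η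
has the same norm at both. -/
lemma norm_eta_eq_of_norm_eq_one {τ : ℂ} (hτ : 0 < τ.im) (h1 : ‖τ‖ = 1) :
    2 ^ 12 * ‖eta (2 * τ)‖ ^ 24 = ‖eta (τ / 2)‖ ^ 24 := by
  have hS := norm_eta_neg_inv_pow (z := τ / 2) (by simpa using hτ)
  have hinv : -(τ / 2)⁻¹ = -(2 * starRingEnd ℂ τ) := by
    rw [inv_div, div_eq_mul_inv, Complex.inv_def, normSq_eq_norm_sq, h1]
    simp
  have hq : cexp (2 * Real.pi * I * -(2 * starRingEnd ℂ τ)) =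
      starRingEnd ℂ (cexp (2 * Real.pi * I * (2 * τ))) := by
    rw [← Complex.exp_conj]
    congr 1
    simp [conj_ofNat]
  have hlt : ‖cexp (2 * Real.pi * I * (2 * τ))‖ < 1 := by
    rw [show 2 * Real.pi * I * (2 * τ) = Real.pi * I * (4 * τ) by ring, norm_cexp_pi_mul,
      Real.exp_lt_one_iff]
    simp [Real.pi_pos, hτ]
  rw [hinv, norm_eta_pow, hq, eulerNorm_conj _ hlt, Complex.norm_conj,
    ← norm_eta_pow, norm_div, h1] at hS
  rw [hS]
  norm_num
  ring

lemma norm_cexp_le {τ : ℂ} (h0 : 0 < τ.im) (h1 : 3 ≤ 4 * τ.im ^ 2) :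
    ‖cexp (Real.pi * I * τ)‖ ≤ 1 / 12 := by
  rw [norm_cexp_pi_mul, Real.exp_neg, one_div]
  apply inv_anti₀ (by norm_num)
  -- Then π Im τ ≥ 5/2, and e⁵ ≥ 144 gives e^(5/2) ≥ 12.
  have h2 : (5 / 6 : ℝ) ≤ τ.im := by nlinarith
  have h3 : (5 / 2 : ℝ) ≤ Real.pi * τ.im := by nlinarith [Real.pi_gt_three]
  refine le_trans ?_ (Real.exp_le_exp.2 h3)
  have h4 : Real.exp (5 / 2) ^ 2 = Real.exp 1 ^ 5 := by
    rw [← Real.exp_nat_mul, ← Real.exp_nat_mul]; norm_num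
  have h5 : (2.718 : ℝ) ^ 5 ≤ Real.exp 1 ^ 5 := by
    gcongr
    linarith [Real.exp_one_gt_d9]
  have h6 : (144 : ℝ) ≤ Real.exp (5 / 2) ^ 2 := by
    rw [h4]; refine le_trans ?_ h5; norm_num
  nlinarith [Real.exp_pos (5 / 2)]

lemma norm_eta_lt_of_one_lt_norm {τ : ℂ} (hτ : 0 < τ.im) (hre : |τ.re| ≤ 1 / 2)
    (h1 : 1 < ‖τ‖) :
    2 ^ 12 * ‖eta (2 * τ)‖ ^ 24 < ‖eta (τ / 2)‖ ^ 24 := by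
  have hx : τ.re ^ 2 ≤ 1 / 4 := by
    rw [← sq_abs]; nlinarith [abs_nonneg τ.re]
  -- The point of the unit circle vertically below τ: the two values of p then differ by a positive
  -- real factor s < 1, and equality is known at τ₀.
  set τ₀ : ℂ := ⟨τ.re, √(1 - τ.re ^ 2)⟩ with hτ₀
  have him : τ₀.im ^ 2 = 1 - τ.re ^ 2 := Real.sq_sqrt (by linarith)
  have him0 : 0 < τ₀.im := Real.sqrt_pos.2 (by linarith)
  have hn₀ : ‖τ₀‖ = 1 := by
    rw [← pow_left_inj₀ (norm_nonneg _) zero_le_one two_ne_zero, ← normSq_eq_norm_sq, normSq_apply]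
    linear_combination him
  have hlt : τ₀.im < τ.im := by
    have h2 : 1 < ‖τ‖ ^ 2 := by nlinarith
    rw [← normSq_eq_norm_sq, normSq_apply] at h2
    nlinarith
  set s := Real.exp (-(Real.pi * (τ.im - τ₀.im))) with hs
  have hs1 : s < 1 := by
    rw [hs, Real.exp_lt_one_iff]
    have := mul_pos Real.pi_pos (sub_pos.2 hlt)
    linarith
  have hp : cexp (Real.pi * I * τ) = s * cexp (Real.pi * I * τ₀) := by
    rw [hs, ofReal_exp, ← Complex.exp_add]
    congr 1
    apply Complex.ext
    · simp; ring
    · simp [hτ₀]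
  have key := norm_mul_eulerNorm_lt (Complex.exp_ne_zero (Real.pi * I * τ₀))
    (norm_cexp_le him0 (by linarith)) (Real.exp_pos _) hs1
  rw [← hs, ← hp] at key
  have harc := norm_eta_eq_of_norm_eq_one him0 hn₀
  rw [norm_eta_half_pow, norm_eta_two_mul_pow] at harc
  rw [norm_eta_half_pow, norm_eta_two_mul_pow]
  have hpos₀ : 0 < ‖cexp (Real.pi * I * τ₀)‖ := norm_pos_iff.2 (Complex.exp_ne_zero _)
  have hpos : 0 < ‖cexp (Real.pi * I * τ)‖ := norm_pos_iff.2 (Complex.exp_ne_zero _)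
  have hE₀ : 0 < eulerNorm (cexp (Real.pi * I * τ₀)) :=
    eulerNorm_pos (by linarith [norm_cexp_le him0 (by linarith)])
  generalize ‖cexp (Real.pi * I * τ₀)‖ = r₀ at *
  generalize ‖cexp (Real.pi * I * τ)‖ = r at *
  generalize eulerNorm (cexp (Real.pi * I * τ₀)) = a₀ at *
  generalize eulerNorm (cexp (Real.pi * I * τ₀) ^ 4) = b₀ at *
  generalize eulerNorm (cexp (Real.pi * I * τ)) = a at *
  generalize eulerNorm (cexp (Real.pi * I * τ) ^ 4) = b at *
  have harc' : 2 ^ 12 * r₀ ^ 3 * b₀ ^ 24 = a₀ ^ 24 := by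
    apply mul_left_cancel₀ hpos₀.ne'
    linear_combination harc
  -- The ratio of the two sides of the goal is 2¹² times the cube of the radially monotone quantity.
  have key' : (r * b ^ 8 * a₀ ^ 8) ^ 3 < (r₀ * b₀ ^ 8 * a ^ 8) ^ 3 := by gcongr
  refine lt_of_mul_lt_mul_right ?_ (pow_pos hE₀ 24).le
  calc 2 ^ 12 * (r ^ 4 * b ^ 24) * a₀ ^ 24 = 2 ^ 12 * r * (r * b ^ 8 * a₀ ^ 8) ^ 3 := by ring
    _ < 2 ^ 12 * r * (r₀ * b₀ ^ 8 * a ^ 8) ^ 3 := by gcongr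
    _ = r * a ^ 24 * (2 ^ 12 * r₀ ^ 3 * b₀ ^ 24) := by ring
    _ = _ := by rw [harc']

lemma norm_eta_half_le {τ : ℂ} (hτ : 0 < τ.im) (h1 : 3 ≤ 4 * τ.im ^ 2) (hre : |τ.re| ≤ 1 / 2) :
    ‖eta (τ / 2)‖ ^ 24 ≤ ‖eta ((τ + 1) / 2)‖ ^ 24 ∧
      (|τ.re| < 1 / 2 → ‖eta (τ / 2)‖ ^ 24 < ‖eta ((τ + 1) / 2)‖ ^ 24) := by
  have hpre : (cexp (Real.pi * I * τ)).re =
      Real.exp (-(Real.pi * τ.im)) * Real.cos (Real.pi * τ.re) := by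
    rw [Complex.exp_re]; simp
  have hp := norm_cexp_le hτ h1
  obtain ⟨hl, hr⟩ := abs_le.1 hre
  have hpi := Real.pi_pos
  have hre0 : 0 ≤ (cexp (Real.pi * I * τ)).re := by
    rw [hpre]
    exact mul_nonneg (Real.exp_pos _).le (Real.cos_nonneg_of_mem_Icc ⟨by nlinarith, by nlinarith⟩)
  have hsq := eulerNorm_sq_le hp hre0
  have hpos : 0 < ‖cexp (Real.pi * I * τ)‖ := norm_pos_iff.2 (Complex.exp_ne_zero _)
  have hE := eulerNorm_pos (q := cexp (Real.pi * I * τ)) (by linarith)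
  have hE' := eulerNorm_pos (q := -cexp (Real.pi * I * τ)) (by rw [norm_neg]; linarith)
  rw [norm_eta_half_pow, norm_eta_half_add_pow]
  refine ⟨?_, fun hlt ↦ ?_⟩
  · have : Real.exp (-2 * (cexp (Real.pi * I * τ)).re) ≤ 1 := Real.exp_le_one_iff.2 (by linarith)
    have : eulerNorm (cexp (Real.pi * I * τ)) ≤ eulerNorm (-cexp (Real.pi * I * τ)) := by
      refine le_of_sq_le_sq ?_ hE'.le
      nlinarith [sq_nonneg (eulerNorm (-cexp (Real.pi * I * τ)))]
    gcongr
  · obtain ⟨hl, hr⟩ := abs_lt.1 hlt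
    have hre1 : 0 < (cexp (Real.pi * I * τ)).re := by
      rw [hpre]
      exact mul_pos (Real.exp_pos _) (Real.cos_pos_of_mem_Ioo ⟨by nlinarith, by nlinarith⟩)
    have : Real.exp (-2 * (cexp (Real.pi * I * τ)).re) < 1 := Real.exp_lt_one_iff.2 (by linarith)
    have : eulerNorm (cexp (Real.pi * I * τ)) < eulerNorm (-cexp (Real.pi * I * τ)) := by
      refine lt_of_pow_lt_pow_left₀ 2 hE'.le (hsq.trans_lt ?_)
      exact mul_lt_of_lt_one_right (by positivity) this
    gcongr

/-- Here p is purely imaginary, so −p is its complex conjugate. -/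
lemma norm_eta_half_add_eq {τ : ℂ} (hτ : 0 < τ.im) (h1 : 3 ≤ 4 * τ.im ^ 2)
    (hre : |τ.re| = 1 / 2) : ‖eta ((τ + 1) / 2)‖ ^ 24 = ‖eta (τ / 2)‖ ^ 24 := by
  have hpre : (cexp (Real.pi * I * τ)).re = 0 := by
    rw [Complex.exp_re]
    have : Real.cos (Real.pi * τ.re) = 0 := by
      rw [← Real.cos_abs, abs_mul, hre, abs_of_pos Real.pi_pos, mul_one_div, Real.cos_pi_div_two]
    simp [this]
  have hconj : -cexp (Real.pi * I * τ) = starRingEnd ℂ (cexp (Real.pi * I * τ)) := by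
    apply Complex.ext <;> simp [hpre]
  rw [norm_eta_half_add_pow, norm_eta_half_pow, hconj,
    eulerNorm_conj _ (by linarith [norm_cexp_le hτ h1])]

end LandenLattice

/-! ### Translation to `PeriodPair` and to modular forms. -/

namespace LandenLattice

open Complex Filter Topology

lemma tsum_ne_zero_eq (L : PeriodPair) (f : ℂ → ℂ) :
    ∑' u : {u : ℂ // u ∈ L.lattice.toAddSubgroup ∧ u ≠ 0}, f u =
      ∑' u : L.lattice, if (u : ℂ) = 0 then 0 else f u := by
  have h1 := tsum_subtype {u : ℂ | u ∈ L.lattice.toAddSubgroup ∧ u ≠ 0} f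
  have h2 := tsum_subtype (L.lattice : Set ℂ) (fun u : ℂ ↦ if u = 0 then 0 else f u)
  refine h1.trans (Eq.trans ?_ h2.symm)
  refine tsum_congr fun u ↦ ?_
  by_cases hu : u ∈ L.lattice <;> by_cases h0 : u = 0 <;> simp [Set.indicator, hu, h0]

lemma g₂_lattice (L : PeriodPair) : g₂ L.lattice.toAddSubgroup = L.g₂ := by
  rw [g₂, tsum_ne_zero_eq L (fun u ↦ 60 / u ^ 4), PeriodPair.g₂, PeriodPair.G, ← tsum_mul_left]
  refine tsum_congr fun u ↦ ?_
  split_ifs with h <;> simp [h, div_eq_mul_inv]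

lemma g₃_lattice (L : PeriodPair) : g₃ L.lattice.toAddSubgroup = L.g₃ := by
  rw [g₃, tsum_ne_zero_eq L (fun u ↦ 140 / u ^ 6), PeriodPair.g₃, PeriodPair.G, ← tsum_mul_left]
  refine tsum_congr fun u ↦ ?_
  split_ifs with h <;> simp [h, div_eq_mul_inv]

lemma wp_lattice (L : PeriodPair) (z : ℂ) :
    wp L.lattice.toAddSubgroup z = L.weierstrassP z := by
  rw [wp, tsum_ne_zero_eq L (fun u ↦ 1 / (z - u) ^ 2 - 1 / u ^ 2),
    -- The term split off at the lattice point 0 is 1/z² − 1/0², which is 1/z² because division by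
    -- zero gives 0.
    ← L.weierstrassPExcept_add 0 z, PeriodPair.weierstrassPExcept]
  simp [add_comm]

lemma discr_lattice (L : PeriodPair) :
    discr L.lattice.toAddSubgroup = L.g₂ ^ 3 - 27 * L.g₃ ^ 2 := by
  rw [discr, g₂_lattice, g₃_lattice]

lemma G_eq_eisensteinSeries (L : PeriodPair) {k : ℕ} (hk : 3 ≤ k) (τ : UpperHalfPlane)
    (hτ : L.ω₂ = L.ω₁ * τ) :
    L.G k = (L.ω₁ ^ k)⁻¹ * (2 * riemannZeta k * ModularForm.E hk τ) := by
  have hE : ModularForm.E hk τ = (1 / 2 : ℂ) * eisensteinSeries (N := 1) 0 k τ := by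
    rw [← EisensteinSeries.eisensteinSeriesSIF_apply 0 k τ]
    rfl
  rw [hE, show (2 * riemannZeta k * (1 / 2 * eisensteinSeries (N := 1) 0 k τ) : ℂ) =
    riemannZeta k * eisensteinSeries (N := 1) 0 k τ by ring,
    ← tsum_eisSummand_eq_riemannZeta_mul_eisensteinSeries hk, ← tsum_mul_left,
    PeriodPair.G]
  -- The coordinates are swapped because `eisSummand` attaches τ to the index 0, while the lattice
  -- coordinates list ω₁ first.
  let e : (Fin 2 → ℤ) ≃ L.lattice :=
    (finTwoArrowEquiv ℤ).trans ((Equiv.prodComm _ _).trans L.latticeEquivProd.symm.toEquiv)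
  rw [← e.tsum_eq]
  refine tsum_congr fun v ↦ ?_
  have he : ((e v : L.lattice) : ℂ) = v 1 * L.ω₁ + v 0 * L.ω₂ :=
    L.latticeEquiv_symm_apply (v 1, v 0)
  rw [he, hτ, EisensteinSeries.eisSummand, zpow_neg, zpow_natCast, ← mul_inv, ← mul_pow]
  congr 2
  ring

lemma riemannZeta_six : riemannZeta 6 = (Real.pi : ℂ) ^ 6 / 945 := by
  have := riemannZeta_two_mul_nat (k := 3) (by norm_num)
  rw [show bernoulli (2 * 3) = 1 / 42 by decide +kernel] at this
  norm_num at this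
  rw [this]
  ring

lemma discr_eq_discriminant (L : PeriodPair) (τ : UpperHalfPlane) (hτ : L.ω₂ = L.ω₁ * τ) :
    discr L.lattice.toAddSubgroup =
      4096 * Real.pi ^ 12 * (L.ω₁ ^ 12)⁻¹ * ModularForm.discriminant τ := by
  have h4 := G_eq_eisensteinSeries L (k := 4) (by norm_num) τ hτ
  have h6 := G_eq_eisensteinSeries L (k := 6) (by norm_num) τ hτ
  rw [show ((4 : ℕ) : ℂ) = 4 by norm_num, riemannZeta_four] at h4
  rw [show ((6 : ℕ) : ℂ) = 6 by norm_num, riemannZeta_six] at h6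
  rw [discr_lattice, PeriodPair.g₂, PeriodPair.g₃, h4, h6,
    ModularForm.discriminant_eq_E₄_cube_sub_E₆_sq]
  ring

lemma norm_discr_eq (L : PeriodPair) {τ : ℂ} (h0 : 0 < τ.im) (hτ : L.ω₂ = L.ω₁ * τ) :
    ‖discr L.lattice.toAddSubgroup‖ =
      4096 * Real.pi ^ 12 * (‖L.ω₁‖ ^ 12)⁻¹ * ‖ModularForm.eta τ‖ ^ 24 := by
  rw [discr_eq_discriminant L ⟨τ, h0⟩ hτ, ModularForm.discriminant]
  simp [abs_of_pos Real.pi_pos]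

lemma discr_ne_zero (L : PeriodPair) (τ : UpperHalfPlane) (hτ : L.ω₂ = L.ω₁ * τ) :
    discr L.lattice.toAddSubgroup ≠ 0 := by
  rw [discr_eq_discriminant L τ hτ]
  have h1 : L.ω₁ ≠ 0 := L.indep.ne_zero 0
  have := ModularForm.discriminant_ne_zero τ
  have := Real.pi_ne_zero
  simp_all

/-! ### The differential equation of ℘ and its values at half periods. -/

section HalfPeriods

variable (L : PeriodPair)

lemma isPreconnected_compl_lattice : IsPreconnected ((L.lattice : Set ℂ)ᶜ) := by
  have : Countable L.lattice := L.latticeEquivProd.toEquiv.countable_iff.2 inferInstance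
  exact ((Set.to_countable (L.lattice : Set ℂ)).isConnected_compl_of_one_lt_rank
    (by simp)).isPreconnected

/-- ℘′ has a triple pole at 0: if it vanished off the lattice, z³ times an analytic function would
equal 2 near 0. -/
lemma exists_derivWeierstrassP_ne_zero : ∃ z ∉ L.lattice, L.derivWeierstrassP z ≠ 0 := by
  by_contra! H
  have hc : ContinuousAt (fun z ↦ z ^ 3 * L.derivWeierstrassPExcept 0 z) 0 :=
    (continuousAt_id.pow 3).mul (L.analyticAt_derivWeierstrassPExcept 0).continuousAt
  have h1 : Tendsto (fun z ↦ z ^ 3 * L.derivWeierstrassPExcept 0 z) (𝓝[≠] 0) (𝓝 0) := by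
    simpa using hc.tendsto.mono_left nhdsWithin_le_nhds
  have h2 : ∀ᶠ z in 𝓝[≠] (0 : ℂ), z ^ 3 * L.derivWeierstrassPExcept 0 z = 2 := by
    filter_upwards [mem_nhdsWithin_of_mem_nhds (L.compl_lattice_sdiff_singleton_mem_nhds 0),
      self_mem_nhdsWithin] with z hz hz0
    have hz0 : z ≠ 0 := hz0
    have hzl : z ∉ L.lattice := fun h ↦ hz ⟨h, hz0⟩
    have := L.derivWeierstrassPExcept_def 0 z
    rw [H z hzl] at this
    simp only [ZeroMemClass.coe_zero, sub_zero, zero_add] at this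
    rw [this]
    field_simp
  have h3 := tendsto_nhds_unique (h1.congr' h2) tendsto_const_nhds
  norm_num at h3

/-- Differentiating the cubic equation gives the identity only after multiplication by ℘′, which
vanishes at the half periods, where it is needed. The identity theorem on the connected complement
of the lattice removes the factor. -/
lemma deriv_derivWeierstrassP {z : ℂ} (hz : z ∉ L.lattice) :
    deriv L.derivWeierstrassP z = 6 * L.weierstrassP z ^ 2 - L.g₂ / 2 := by
  have hopen : IsOpen ((L.lattice : Set ℂ)ᶜ) := L.isClosed_lattice.isOpen_compl
  have hP := L.analyticOnNhd_weierstrassP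
  have hP' := L.analyticOnNhd_derivWeierstrassP
  have hprod : ∀ w ∈ (L.lattice : Set ℂ)ᶜ, L.derivWeierstrassP w *
      (deriv L.derivWeierstrassP w - (6 * L.weierstrassP w ^ 2 - L.g₂ / 2)) = 0 := by
    intro w hw
    have hdP : HasDerivAt L.weierstrassP (L.derivWeierstrassP w) w := by
      rw [← L.deriv_weierstrassP]
      exact (hP w hw).differentiableAt.hasDerivAt
    have hdP' := (hP' w hw).differentiableAt.hasDerivAt
    have h1 := hdP'.pow 2
    have h2 := ((hdP.pow 3).const_mul 4).sub (hdP.const_mul L.g₂) |>.sub_const L.g₃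
    have heq : (fun w ↦ L.derivWeierstrassP w ^ 2) =ᶠ[𝓝 w]
        fun w ↦ 4 * L.weierstrassP w ^ 3 - L.g₂ * L.weierstrassP w - L.g₃ := by
      filter_upwards [hopen.mem_nhds hw] with v hv using L.derivWeierstrassP_sq v hv
    have h3 := h1.unique (h2.congr_of_eventuallyEq heq)
    simp only [Nat.cast_ofNat, Nat.add_one_sub_one, pow_one] at h3
    linear_combination h3 / 2
  have := AnalyticOnNhd.eq_zero_or_eq_zero_of_mul_eq_zero hP'
    (hP'.deriv.sub ((analyticOnNhd_const.mul (hP.pow 2)).sub analyticOnNhd_const)) hprod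
    (isPreconnected_compl_lattice L)
  rcases this with h | h
  · obtain ⟨w, hw, hne⟩ := exists_derivWeierstrassP_ne_zero L
    exact absurd (h w hw) hne
  · exact sub_eq_zero.1 (h z hz)

lemma iteratedDeriv_weierstrassP {z : ℂ} (hz : z ∉ L.lattice) {n : ℕ} (hn : n ≠ 0) :
    iteratedDeriv n L.weierstrassP z = (n + 1).factorial * L.sumInvPow z (n + 2) := by
  have h := L.iteratedDeriv_weierstrassPExcept_self z (n := n)
  rwa [L.weierstrassPExcept_of_notMem z hz, if_neg hn] at h

lemma iteratedDeriv_two_weierstrassP {z : ℂ} (hz : z ∉ L.lattice) :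
    iteratedDeriv 2 L.weierstrassP z = 6 * L.weierstrassP z ^ 2 - L.g₂ / 2 := by
  rw [iteratedDeriv_succ, iteratedDeriv_one, L.deriv_weierstrassP, deriv_derivWeierstrassP L hz]

lemma iteratedDeriv_four_weierstrassP {z : ℂ} (hz : z ∉ L.lattice) :
    iteratedDeriv 4 L.weierstrassP z = 12 * L.derivWeierstrassP z ^ 2 +
      12 * L.weierstrassP z * (6 * L.weierstrassP z ^ 2 - L.g₂ / 2) := by
  have hopen : IsOpen ((L.lattice : Set ℂ)ᶜ) := L.isClosed_lattice.isOpen_compl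
  have hdP : ∀ w ∉ L.lattice, HasDerivAt L.weierstrassP (L.derivWeierstrassP w) w := by
    intro w hw
    rw [← L.deriv_weierstrassP]
    exact (L.analyticOnNhd_weierstrassP w hw).differentiableAt.hasDerivAt
  have h3 : ∀ w ∉ L.lattice, iteratedDeriv 3 L.weierstrassP w =
      12 * L.weierstrassP w * L.derivWeierstrassP w := by
    intro w hw
    rw [iteratedDeriv_succ]
    have heq : iteratedDeriv 2 L.weierstrassP =ᶠ[𝓝 w]
        fun w ↦ 6 * L.weierstrassP w ^ 2 - L.g₂ / 2 := by
      filter_upwards [hopen.mem_nhds hw] with v hv using iteratedDeriv_two_weierstrassP L hv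
    refine heq.deriv_eq.trans
      ((((hdP w hw).pow 2).const_mul 6 |>.sub_const (L.g₂ / 2)).deriv.trans ?_)
    push_cast
    ring
  rw [iteratedDeriv_succ]
  have heq : iteratedDeriv 3 L.weierstrassP =ᶠ[𝓝 z]
      fun w ↦ 12 * L.weierstrassP w * L.derivWeierstrassP w := by
    filter_upwards [hopen.mem_nhds hz] with v hv using h3 v hv
  have hd := (L.analyticOnNhd_derivWeierstrassP z hz).differentiableAt.hasDerivAt
  rw [deriv_derivWeierstrassP L hz] at hd
  refine heq.deriv_eq.trans ((((hdP z hz).const_mul 12).mul hd).deriv.trans ?_)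
  ring

variable {L} {x : ℂ}

lemma derivWeierstrassP_half_period (h2 : 2 * x ∈ L.lattice) : L.derivWeierstrassP x = 0 := by
  have h := L.derivWeierstrassP_sub_coe x ⟨2 * x, h2⟩
  rw [show x - ((⟨2 * x, h2⟩ : L.lattice) : ℂ) = -x by simp; ring, L.derivWeierstrassP_neg] at h
  linear_combination -h / 2

lemma cubic_half_period (hx : x ∉ L.lattice) (h2 : 2 * x ∈ L.lattice) :
    4 * L.weierstrassP x ^ 3 - L.g₂ * L.weierstrassP x - L.g₃ = 0 := by
  rw [← L.derivWeierstrassP_sq x hx, derivWeierstrassP_half_period h2]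
  simp

lemma sumInvPow_four_half_period (hx : x ∉ L.lattice) :
    60 * L.sumInvPow x 4 = 60 * L.weierstrassP x ^ 2 - 5 * L.g₂ := by
  have h := iteratedDeriv_weierstrassP L hx (n := 2) (by norm_num)
  rw [iteratedDeriv_two_weierstrassP L hx] at h
  norm_num [Nat.factorial] at h
  linear_combination -10 * h

lemma sumInvPow_six_half_period (hx : x ∉ L.lattice) (h2 : 2 * x ∈ L.lattice) :
    140 * L.sumInvPow x 6 = 84 * L.weierstrassP x ^ 3 - 7 * L.g₂ * L.weierstrassP x := by
  have h := iteratedDeriv_weierstrassP L hx (n := 4) (by norm_num)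
  rw [iteratedDeriv_four_weierstrassP L hx, derivWeierstrassP_half_period h2] at h
  norm_num [Nat.factorial] at h
  linear_combination -7 / 6 * h

end HalfPeriods

/-! ### Eisenstein sums over cosets, and discriminants of sublattices. -/

/-- L′ is the disjoint union of the sets 2(Γ − cᵢ), and the sum converges absolutely for k > 2. It
serves for an index two sublattice, with centres 0 and x, and for Γ itself, with all four half
periods. -/
lemma two_pow_mul_G_eq_sum (L L' : PeriodPair) {ι : Type*} [Fintype ι] (c : ι → ℂ)
    (hL' : ∀ x, x ∈ L'.lattice ↔ ∃ i, ∃ v ∈ L.lattice, x = 2 * (v - c i))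
    (hinj : ∀ i j, c i - c j ∈ L.lattice → i = j) {k : ℕ} (hk : 2 < k) :
    2 ^ k * L'.G k = ∑ i, L.sumInvPow (c i) k := by
  let e : ι × L.lattice ≃ L'.lattice := Equiv.ofBijective
    (fun p ↦ ⟨2 * (p.2 - c p.1), (hL' _).2 ⟨p.1, p.2, p.2.2, rfl⟩⟩) <| by
      constructor
      · rintro ⟨i, v⟩ ⟨j, w⟩ h
        have h1 : 2 * ((v : ℂ) - c i) = 2 * (w - c j) := congrArg Subtype.val h
        have h2 : c i - c j = v - w := by linear_combination -h1 / 2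
        have hij : i = j := hinj i j (h2 ▸ sub_mem v.2 w.2)
        subst hij
        have h3 : (v : ℂ) = w := by linear_combination h1 / 2
        exact Prod.ext rfl (Subtype.ext h3)
      · rintro ⟨x, hx⟩
        obtain ⟨i, v, hv, rfl⟩ := (hL' x).1 hx
        exact ⟨(i, ⟨v, hv⟩), rfl⟩
  have hsum := L'.hasSum_sumInvPow 0 hk
  have hs := e.summable_iff.2 hsum.summable
  have hG : L'.G k = ∑' p : ι × L.lattice, ((2 : ℂ) ^ k)⁻¹ * ((p.2 - c p.1) ^ k)⁻¹ := by
    rw [← L'.sumInvPow_zero, ← hsum.tsum_eq, ← e.tsum_eq]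
    refine tsum_congr fun p ↦ ?_
    rw [← mul_inv, ← mul_pow, sub_zero]
    rfl
  have hs' : Summable fun p : ι × L.lattice ↦ ((p.2 - c p.1 : ℂ) ^ k)⁻¹ := by
    refine (hs.mul_left (2 ^ k)).congr fun p ↦ ?_
    have : ((e p : L'.lattice) : ℂ) = 2 * (p.2 - c p.1) := rfl
    simp only [Function.comp, sub_zero, this, mul_pow, mul_inv]
    field_simp
  rw [hG, tsum_mul_left, ← mul_assoc, mul_inv_cancel₀ (pow_ne_zero _ two_ne_zero), one_mul,
    hs'.tsum_prod' fun i ↦ (L.hasSum_sumInvPow (c i) hk).summable, tsum_fintype]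
  rfl

/-- The invariants of `2Γ + ℤw` for `w = 2x ∈ Γ \ 2Γ`. -/
lemma discr_of_half_period (L L' : PeriodPair) {x : ℂ} (hx : x ∉ L.lattice)
    (h2 : 2 * x ∈ L.lattice)
    (hL' : ∀ y, y ∈ L'.lattice ↔ (∃ v ∈ L.lattice, y = 2 * v) ∨ ∃ v ∈ L.lattice, y = 2 * (v - x)) :
    64 * discr L'.lattice.toAddSubgroup =
      (12 * L.weierstrassP x ^ 2 - L.g₂) * (3 * L.weierstrassP x ^ 2 - L.g₂) ^ 2 := by
  have hc : ∀ y, y ∈ L'.lattice ↔ ∃ i, ∃ v ∈ L.lattice, y = 2 * (v - ![0, x] i) := by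
    intro y
    rw [hL' y, Fin.exists_fin_two]
    simp
  have hinj : ∀ i j, ![0, x] i - ![0, x] j ∈ L.lattice → i = j := by
    intro i j
    fin_cases i <;> fin_cases j <;> simp [hx]
  have h4 := two_pow_mul_G_eq_sum L L' ![0, x] hc hinj (k := 4) (by norm_num)
  have h6 := two_pow_mul_G_eq_sum L L' ![0, x] hc hinj (k := 6) (by norm_num)
  simp only [Fin.sum_univ_two, Matrix.cons_val_zero, Matrix.cons_val_one, L.sumInvPow_zero] at h4 h6
  have hS4 := sumInvPow_four_half_period hx
  have hS6 := sumInvPow_six_half_period hx h2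
  have hcub := cubic_half_period hx h2
  have hg2 : L'.g₂ = (15 * L.weierstrassP x ^ 2 - L.g₂) / 4 := by
    rw [PeriodPair.g₂] at hS4 ⊢
    rw [PeriodPair.g₂]
    linear_combination 60 / 16 * h4 + hS4 / 16
  -- The cubic equation for ℘(x) eliminates g₃(Γ).
  have hg3 : L'.g₃ = (11 * L.weierstrassP x ^ 3 - L.g₂ * L.weierstrassP x) / 8 := by
    have h1 : L.g₃ = 140 * L.G 6 := rfl
    rw [PeriodPair.g₃]
    linear_combination 140 / 64 * h6 + hS6 / 64 - h1 / 64 - hcub / 64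
  rw [discr_lattice, hg2, hg3]
  ring

/-- The period pair `(ω, ωτ)` for `τ` in the upper half plane. -/
noncomputable def latticePair (ω τ : ℂ) (hω : ω ≠ 0) (hτ : 0 < τ.im) : PeriodPair where
  ω₁ := ω
  ω₂ := ω * τ
  indep := by
    rw [LinearIndependent.pair_iff]
    intro s t h
    have h1 : (s : ℂ) + t * τ = 0 := by
      apply mul_left_cancel₀ hω
      simp only [real_smul] at h
      linear_combination h
    have h2 : t = 0 := by simpa [hτ.ne'] using congrArg im h1
    subst h2
    exact ⟨by simpa using h1, rfl⟩

section LatticePair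

variable {ω τ : ℂ} (hω : ω ≠ 0) (hτ : 0 < τ.im)

lemma mem_latticePair {x : ℂ} :
    x ∈ (latticePair ω τ hω hτ).lattice ↔ ∃ m n : ℤ, x = m * ω + n * (ω * τ) := by
  rw [PeriodPair.mem_lattice]
  exact ⟨fun ⟨m, n, h⟩ ↦ ⟨m, n, h.symm⟩, fun ⟨m, n, h⟩ ↦ ⟨m, n, h.symm⟩⟩

lemma coeff_unique (hω : ω ≠ 0) (hτ : 0 < τ.im) {a b c d : ℤ}
    (h : (a * ω + b * (ω * τ) : ℂ) = c * ω + d * (ω * τ)) : a = c ∧ b = d := by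
  have h1 : (a + b * τ : ℂ) = c + d * τ := by
    apply mul_left_cancel₀ hω
    linear_combination h
  have h2 : b = d := by simpa [hτ.ne'] using congrArg im h1
  subst h2
  exact ⟨by simpa using h1, rfl⟩

lemma half_mem_latticePair {a b : ℤ} :
    (a * ω + b * (ω * τ)) / 2 ∈ (latticePair ω τ hω hτ).lattice ↔ Even a ∧ Even b := by
  rw [mem_latticePair]
  constructor
  · rintro ⟨m, n, h⟩
    have h' : (a * ω + b * (ω * τ) : ℂ) = (m + m : ℤ) * ω + (n + n : ℤ) * (ω * τ) := by
      push_cast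
      linear_combination 2 * h
    obtain ⟨h1, h2⟩ := coeff_unique hω hτ h'
    exact ⟨⟨m, h1⟩, ⟨n, h2⟩⟩
  · rintro ⟨⟨m, rfl⟩, ⟨n, rfl⟩⟩
    exact ⟨m, n, by push_cast; ring⟩

/-- The sublattice of index two spanned by `ω` and `2ωτ`. -/
noncomputable def subpair₁ (hω : ω ≠ 0) (hτ : 0 < τ.im) : PeriodPair :=
  latticePair ω (2 * τ) hω (by simpa using hτ)

/-- The sublattice of index two spanned by `2ω` and `ωτ`. -/
noncomputable def subpair₂ (hω : ω ≠ 0) (hτ : 0 < τ.im) : PeriodPair :=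
  latticePair (2 * ω) (τ / 2) (by simpa using hω) (by simpa using hτ)

/-- The sublattice of index two spanned by `2ω` and `ω + ωτ`. -/
noncomputable def subpair₃ (hω : ω ≠ 0) (hτ : 0 < τ.im) : PeriodPair :=
  latticePair (2 * ω) ((τ + 1) / 2) (by simpa using hω) (by simpa using hτ)

lemma mem_subpair₁ {x : ℂ} :
    x ∈ (subpair₁ hω hτ).lattice ↔ ∃ m n : ℤ, Even n ∧ x = m * ω + n * (ω * τ) := by
  rw [subpair₁, mem_latticePair]
  constructor
  · rintro ⟨m, n, rfl⟩
    exact ⟨m, n + n, ⟨n, rfl⟩, by push_cast; ring⟩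
  · rintro ⟨m, _, ⟨n, rfl⟩, rfl⟩
    exact ⟨m, n, by push_cast; ring⟩

lemma mem_subpair₂ {x : ℂ} :
    x ∈ (subpair₂ hω hτ).lattice ↔ ∃ m n : ℤ, Even m ∧ x = m * ω + n * (ω * τ) := by
  rw [subpair₂, mem_latticePair]
  constructor
  · rintro ⟨m, n, rfl⟩
    exact ⟨m + m, n, ⟨m, rfl⟩, by push_cast; ring⟩
  · rintro ⟨_, n, ⟨m, rfl⟩, rfl⟩
    exact ⟨m, n, by push_cast; ring⟩

lemma mem_subpair₃ {x : ℂ} :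
    x ∈ (subpair₃ hω hτ).lattice ↔ ∃ m n : ℤ, Even (m + n) ∧ x = m * ω + n * (ω * τ) := by
  rw [subpair₃, mem_latticePair]
  constructor
  · rintro ⟨m, n, rfl⟩
    exact ⟨m + m + n, n, ⟨m + n, by ring⟩, by push_cast; ring⟩
  · rintro ⟨m, n, ⟨k, hk⟩, rfl⟩
    obtain rfl : m = k + k - n := by omega
    exact ⟨k - n, n, by push_cast; ring⟩

lemma half₁_notMem : ω / 2 ∉ (latticePair ω τ hω hτ).lattice := by
  have := half_mem_latticePair hω hτ (a := 1) (b := 0)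
  simp only [Int.cast_one, one_mul, Int.cast_zero, zero_mul, add_zero] at this
  simp [this]

lemma half₂_notMem : ω * τ / 2 ∉ (latticePair ω τ hω hτ).lattice := by
  have := half_mem_latticePair hω hτ (a := 0) (b := 1)
  simp only [Int.cast_one, one_mul, Int.cast_zero, zero_mul, zero_add] at this
  simp [this]

lemma half₃_notMem : (ω + ω * τ) / 2 ∉ (latticePair ω τ hω hτ).lattice := by
  have := half_mem_latticePair hω hτ (a := 1) (b := 1)
  simp only [Int.cast_one, one_mul] at this
  simp [this]

lemma half₁_mem : 2 * (ω / 2) ∈ (latticePair ω τ hω hτ).lattice :=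
  (mem_latticePair hω hτ).2 ⟨1, 0, by push_cast; ring⟩

lemma half₂_mem : 2 * (ω * τ / 2) ∈ (latticePair ω τ hω hτ).lattice :=
  (mem_latticePair hω hτ).2 ⟨0, 1, by push_cast; ring⟩

lemma half₃_mem : 2 * ((ω + ω * τ) / 2) ∈ (latticePair ω τ hω hτ).lattice :=
  (mem_latticePair hω hτ).2 ⟨1, 1, by push_cast; ring⟩

lemma discr_subpair₁ : 64 * discr (subpair₁ hω hτ).lattice.toAddSubgroup =
    (12 * (latticePair ω τ hω hτ).weierstrassP (ω / 2) ^ 2 - (latticePair ω τ hω hτ).g₂) *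
    (3 * (latticePair ω τ hω hτ).weierstrassP (ω / 2) ^ 2 - (latticePair ω τ hω hτ).g₂) ^ 2 := by
  refine discr_of_half_period _ _ (half₁_notMem hω hτ) (half₁_mem hω hτ) fun y ↦ ?_
  simp only [mem_subpair₁, mem_latticePair]
  constructor
  · rintro ⟨m, _, ⟨n, rfl⟩, rfl⟩
    rcases Int.even_or_odd' m with ⟨k, rfl | rfl⟩
    · exact .inl ⟨_, ⟨k, n, rfl⟩, by push_cast; ring⟩
    · exact .inr ⟨_, ⟨k + 1, n, rfl⟩, by push_cast; ring⟩
  · rintro (⟨_, ⟨m, n, rfl⟩, rfl⟩ | ⟨_, ⟨m, n, rfl⟩, rfl⟩)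
    · exact ⟨2 * m, n + n, ⟨n, rfl⟩, by push_cast; ring⟩
    · exact ⟨2 * m - 1, n + n, ⟨n, rfl⟩, by push_cast; ring⟩

lemma discr_subpair₂ : 64 * discr (subpair₂ hω hτ).lattice.toAddSubgroup =
    (12 * (latticePair ω τ hω hτ).weierstrassP (ω * τ / 2) ^ 2 - (latticePair ω τ hω hτ).g₂) *
    (3 * (latticePair ω τ hω hτ).weierstrassP (ω * τ / 2) ^ 2 -
      (latticePair ω τ hω hτ).g₂) ^ 2 := by
  refine discr_of_half_period _ _ (half₂_notMem hω hτ) (half₂_mem hω hτ) fun y ↦ ?_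
  simp only [mem_subpair₂, mem_latticePair]
  constructor
  · rintro ⟨_, n, ⟨m, rfl⟩, rfl⟩
    rcases Int.even_or_odd' n with ⟨k, rfl | rfl⟩
    · exact .inl ⟨_, ⟨m, k, rfl⟩, by push_cast; ring⟩
    · exact .inr ⟨_, ⟨m, k + 1, rfl⟩, by push_cast; ring⟩
  · rintro (⟨_, ⟨m, n, rfl⟩, rfl⟩ | ⟨_, ⟨m, n, rfl⟩, rfl⟩)
    · exact ⟨m + m, 2 * n, ⟨m, rfl⟩, by push_cast; ring⟩
    · exact ⟨m + m, 2 * n - 1, ⟨m, rfl⟩, by push_cast; ring⟩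

lemma discr_subpair₃ : 64 * discr (subpair₃ hω hτ).lattice.toAddSubgroup =
    (12 * (latticePair ω τ hω hτ).weierstrassP ((ω + ω * τ) / 2) ^ 2 -
      (latticePair ω τ hω hτ).g₂) *
    (3 * (latticePair ω τ hω hτ).weierstrassP ((ω + ω * τ) / 2) ^ 2 -
      (latticePair ω τ hω hτ).g₂) ^ 2 := by
  refine discr_of_half_period _ _ (half₃_notMem hω hτ) (half₃_mem hω hτ) fun y ↦ ?_
  simp only [mem_subpair₃, mem_latticePair]
  constructor
  · rintro ⟨m, n, ⟨j, hj⟩, rfl⟩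
    obtain rfl : n = j + j - m := by omega
    rcases Int.even_or_odd' m with ⟨k, rfl | rfl⟩
    · exact .inl ⟨_, ⟨k, j - k, rfl⟩, by push_cast; ring⟩
    · exact .inr ⟨_, ⟨k + 1, j - k, rfl⟩, by push_cast; ring⟩
  · rintro (⟨_, ⟨m, n, rfl⟩, rfl⟩ | ⟨_, ⟨m, n, rfl⟩, rfl⟩)
    · exact ⟨2 * m, 2 * n, ⟨m + n, by ring⟩, by push_cast; ring⟩
    · exact ⟨2 * m - 1, 2 * n - 1, ⟨m + n - 1, by ring⟩, by push_cast; ring⟩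

/-- Γ = 2 · (Γ/2), and Γ/2 consists of four translates of Γ. -/
lemma two_pow_mul_G_latticePair {k : ℕ} (hk : 2 < k) :
    2 ^ k * (latticePair ω τ hω hτ).G k = (latticePair ω τ hω hτ).G k +
      (latticePair ω τ hω hτ).sumInvPow (ω / 2) k +
      (latticePair ω τ hω hτ).sumInvPow (ω * τ / 2) k +
      (latticePair ω τ hω hτ).sumInvPow ((ω + ω * τ) / 2) k := by
  let c : Fin 4 → ℂ := ![0, ω / 2, ω * τ / 2, (ω + ω * τ) / 2]
  let a : Fin 4 → ℤ := ![0, 1, 0, 1]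
  let b : Fin 4 → ℤ := ![0, 0, 1, 1]
  have hc : ∀ i, c i = (a i * ω + b i * (ω * τ)) / 2 := by
    intro i
    fin_cases i <;> simp [a, b, c]
  rw [two_pow_mul_G_eq_sum (latticePair ω τ hω hτ) _ c (fun x ↦ ?_) (fun i j h ↦ ?_) hk]
  · simp [Fin.sum_univ_four, c, PeriodPair.sumInvPow_zero]
  · rw [mem_latticePair]
    constructor
    · rintro ⟨m, n, rfl⟩
      rcases Int.even_or_odd' m with ⟨m', rfl | rfl⟩ <;>
        rcases Int.even_or_odd' n with ⟨n', rfl | rfl⟩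
      · exact ⟨0, _, (mem_latticePair hω hτ).2 ⟨m', n', rfl⟩, by simp [c]; ring⟩
      · exact ⟨2, _, (mem_latticePair hω hτ).2 ⟨m', n' + 1, rfl⟩, by simp [c]; ring⟩
      · exact ⟨1, _, (mem_latticePair hω hτ).2 ⟨m' + 1, n', rfl⟩, by simp [c]; ring⟩
      · exact ⟨3, _, (mem_latticePair hω hτ).2 ⟨m' + 1, n' + 1, rfl⟩, by simp [c]; ring⟩
    · rintro ⟨i, v, hv, rfl⟩
      obtain ⟨m, n, rfl⟩ := (mem_latticePair hω hτ).1 hv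
      exact ⟨2 * m - a i, 2 * n - b i, by rw [hc]; push_cast; ring⟩
  · have h' : c i - c j = ((a i - a j : ℤ) * ω + (b i - b j : ℤ) * (ω * τ)) / 2 := by
      rw [hc, hc]; push_cast; ring
    rw [h', half_mem_latticePair] at h
    revert h
    fin_cases i <;> fin_cases j <;> simp [a, b]

/-- The values of `℘` at the half periods satisfy the relations between roots and coefficients. -/
lemma half_period_values_relations (E₁ E₂ E₃ : ℂ)
    (h₁ : E₁ = (latticePair ω τ hω hτ).weierstrassP (ω / 2))
    (h₂ : E₂ = (latticePair ω τ hω hτ).weierstrassP (ω * τ / 2))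
    (h₃ : E₃ = (latticePair ω τ hω hτ).weierstrassP ((ω + ω * τ) / 2)) :
    E₁ + E₂ + E₃ = 0 ∧ (latticePair ω τ hω hτ).g₂ = -4 * (E₁ * E₂ + E₁ * E₃ + E₂ * E₃) ∧
      (latticePair ω τ hω hτ).g₃ = 4 * (E₁ * E₂ * E₃) := by
  have hd := discr_ne_zero (latticePair ω τ hω hτ) ⟨τ, hτ⟩ rfl
  rw [discr_lattice] at hd
  have h4 := two_pow_mul_G_latticePair hω hτ (k := 4) (by norm_num)
  have h6 := two_pow_mul_G_latticePair hω hτ (k := 6) (by norm_num)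
  have a1 := sumInvPow_four_half_period (half₁_notMem hω hτ)
  have a2 := sumInvPow_four_half_period (half₂_notMem hω hτ)
  have a3 := sumInvPow_four_half_period (half₃_notMem hω hτ)
  have b1 := sumInvPow_six_half_period (half₁_notMem hω hτ) (half₁_mem hω hτ)
  have b2 := sumInvPow_six_half_period (half₂_notMem hω hτ) (half₂_mem hω hτ)
  have b3 := sumInvPow_six_half_period (half₃_notMem hω hτ) (half₃_mem hω hτ)
  have c1 := cubic_half_period (half₁_notMem hω hτ) (half₁_mem hω hτ)
  have c2 := cubic_half_period (half₂_notMem hω hτ) (half₂_mem hω hτ)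
  have c3 := cubic_half_period (half₃_notMem hω hτ) (half₃_mem hω hτ)
  rw [← h₁] at a1 b1 c1
  rw [← h₂] at a2 b2 c2
  rw [← h₃] at a3 b3 c3
  have hg2 : (latticePair ω τ hω hτ).g₂ = 60 * (latticePair ω τ hω hτ).G 4 := rfl
  have hg3 : (latticePair ω τ hω hτ).g₃ = 140 * (latticePair ω τ hω hτ).G 6 := rfl
  generalize (latticePair ω τ hω hτ).g₂ = g at *
  generalize (latticePair ω τ hω hτ).g₃ = g' at *
  have hsq : E₁ ^ 2 + E₂ ^ 2 + E₃ ^ 2 = g / 2 := by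
    linear_combination -h4 - (a1 + a2 + a3) / 60 - hg2 / 4
  -- Weight six together with the three cubic equations: the cubes and g₃ cancel.
  have hgs : g * (E₁ + E₂ + E₃) = 0 := by
    linear_combination -(b1 + b2 + b3) / 14 - 3 / 2 * (c1 + c2 + c3) - 10 * h6 - 9 / 2 * hg3
  have hs : E₁ + E₂ + E₃ = 0 := by
    rcases mul_eq_zero.1 hgs with rfl | h
    -- If g₂ = 0, then Δ ≠ 0 forces g₃ ≠ 0, so the pairwise products sum to zero; the squares do as
    -- well, hence so does the square of the sum.
    · have hp : g' * (E₁ * E₂ + E₁ * E₃ + E₂ * E₃) = 0 := by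
        linear_combination 4 * E₁ * E₂ * E₃ * hsq - E₂ * E₃ * c1 - E₁ * E₃ * c2 - E₁ * E₂ * c3
      have hg' : g' ≠ 0 := by
        rintro rfl
        simp at hd
      have hp' := (mul_eq_zero.1 hp).resolve_left hg'
      apply pow_eq_zero_iff two_ne_zero |>.1
      linear_combination hsq + 2 * hp'
    · exact h
  have hpairs : g = -4 * (E₁ * E₂ + E₁ * E₃ + E₂ * E₃) := by
    linear_combination -2 * hsq + 2 * (E₁ + E₂ + E₃) * hs
  refine ⟨hs, hpairs, ?_⟩
  obtain rfl : E₃ = -E₁ - E₂ := by linear_combination hs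
  linear_combination -c1 - E₁ * hpairs

lemma roots_cubic_latticePair (E₁ E₂ E₃ : ℂ)
    (h₁ : E₁ = (latticePair ω τ hω hτ).weierstrassP (ω / 2))
    (h₂ : E₂ = (latticePair ω τ hω hτ).weierstrassP (ω * τ / 2))
    (h₃ : E₃ = (latticePair ω τ hω hτ).weierstrassP ((ω + ω * τ) / 2)) :
    (cubic (latticePair ω τ hω hτ).lattice.toAddSubgroup).roots = {E₁, E₂, E₃} := by
  obtain ⟨hs, hg2, hg3⟩ := half_period_values_relations hω hτ E₁ E₂ E₃ h₁ h₂ h₃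
  have h : cubic (latticePair ω τ hω hτ).lattice.toAddSubgroup =
      Polynomial.C 4 * (({E₁, E₂, E₃} : Multiset ℂ).map fun a ↦
        Polynomial.X - Polynomial.C a).prod := by
    obtain rfl : E₃ = -E₁ - E₂ := by linear_combination hs
    rw [cubic, g₂_lattice, g₃_lattice, hg2, hg3]
    simp only [Multiset.insert_eq_cons, Multiset.map_cons, Multiset.map_singleton,
      Multiset.prod_cons, Multiset.prod_singleton, map_sub, map_mul, map_add, map_neg]
    simp only [map_ofNat]
    ring
  rw [h, Polynomial.roots_C_mul _ (by norm_num), Polynomial.roots_multiset_prod_X_sub_C]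

/-- The squared norm of the discriminant of each sublattice of index two. -/
lemma norm_discr_subpair_sq (E₁ E₂ E₃ : ℂ)
    (h₁ : E₁ = (latticePair ω τ hω hτ).weierstrassP (ω / 2))
    (h₂ : E₂ = (latticePair ω τ hω hτ).weierstrassP (ω * τ / 2))
    (h₃ : E₃ = (latticePair ω τ hω hτ).weierstrassP ((ω + ω * τ) / 2)) :
    ∃ K > 0, ‖discr (subpair₁ hω hτ).lattice.toAddSubgroup‖ ^ 2 = K * ‖E₂ - E₃‖ ^ 6 ∧
      ‖discr (subpair₂ hω hτ).lattice.toAddSubgroup‖ ^ 2 = K * ‖E₁ - E₃‖ ^ 6 ∧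
      ‖discr (subpair₃ hω hτ).lattice.toAddSubgroup‖ ^ 2 = K * ‖E₁ - E₂‖ ^ 6 := by
  obtain ⟨hs, hg2, hg3⟩ := half_period_values_relations hω hτ E₁ E₂ E₃ h₁ h₂ h₃
  have hd := discr_ne_zero (latticePair ω τ hω hτ) ⟨τ, hτ⟩ rfl
  have d1 := discr_subpair₁ hω hτ
  have d2 := discr_subpair₂ hω hτ
  have d3 := discr_subpair₃ hω hτ
  rw [← h₁, hg2] at d1
  rw [← h₂, hg2] at d2
  rw [← h₃, hg2] at d3
  obtain rfl : E₃ = -E₁ - E₂ := by linear_combination hs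
  -- With E₁ + E₂ + E₃ = 0 one has 12E₁² − g₂ = 4(E₁ − E₂)(E₁ − E₃) and 3E₁² − g₂ = −(E₂ − E₃)².
  -- Squaring Δ(Γ₁) lets the symmetric factor D² = Δ(Γ)/16 split off.
  set D := (E₁ - E₂) * (E₁ - (-E₁ - E₂)) * (E₂ - (-E₁ - E₂)) with hD
  have hD0 : D ≠ 0 := by
    intro h
    apply hd
    rw [discr_lattice, hg2, hg3]
    linear_combination 16 * D * h
  have key : ∀ z w : ℂ, z ^ 2 = (1 / 256) * D ^ 2 * w ^ 6 →
      ‖z‖ ^ 2 = ‖(1 / 256) * D ^ 2‖ * ‖w‖ ^ 6 := by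
    intro z w h
    rw [← norm_pow, h, norm_mul, norm_pow]
  refine ⟨‖(1 / 256) * D ^ 2‖, norm_pos_iff.2 (mul_ne_zero (by norm_num) (pow_ne_zero 2 hD0)),
    key _ _ ?_, key _ _ ?_, key _ _ ?_⟩
  · rw [show ∀ z : ℂ, z ^ 2 = (64 * z) ^ 2 / 4096 by intro z; ring, d1, hD]
    ring
  · rw [show ∀ z : ℂ, z ^ 2 = (64 * z) ^ 2 / 4096 by intro z; ring, d2, hD]
    ring
  · rw [show ∀ z : ℂ, z ^ 2 = (64 * z) ^ 2 / 4096 by intro z; ring, d3, hD]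
    ring

end LatticePair

/-! ### Reduced bases. -/

/-- For a discrete group the ℤ-rank equals the real dimension of its span, so a ℤ-basis is
independent over ℝ. -/
lemma IsLattice.exists_basis {Γ : AddSubgroup ℂ} (h : IsLattice Γ) :
    ∃ a b : ℂ, LinearIndependent ℝ ![a, b] ∧ ∀ x, x ∈ Γ ↔ ∃ m n : ℤ, x = m * a + n * b := by
  set S : Submodule ℤ ℂ := AddSubgroup.toIntSubmodule Γ with hS
  have hd : DiscreteTopology S := h.discrete
  have hr : Module.finrank ℤ S = 2 := h.rank_eq_two
  let B := Module.finBasisOfFinrankEq ℤ S hr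
  have hli : LinearIndependent ℤ (fun i ↦ (B i : ℂ)) :=
    B.linearIndependent.map' S.subtype (Submodule.ker_subtype S)
  have hspan : Submodule.span ℤ (Set.range fun i ↦ (B i : ℂ)) = S := by
    have := congrArg (Submodule.map S.subtype) B.span_eq
    rw [Submodule.map_span, ← Set.range_comp, Submodule.map_top, Submodule.range_subtype] at this
    exact this
  have hcard := linearIndependent_iff_card_eq_finrank_span.1 hli
  rw [← Real.finrank_eq_int_finrank_of_discrete (by rw [hspan]; exact hd)] at hcard
  have hR := linearIndependent_iff_card_eq_finrank_span.2 hcard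
  refine ⟨B 0, B 1, ?_, fun x ↦ ?_⟩
  · have e : (fun i ↦ (B i : ℂ)) = ![(B 0 : ℂ), (B 1 : ℂ)] := by
      ext i
      fin_cases i <;> rfl
    rwa [e] at hR
  · constructor
    · intro hx
      have := congrArg Subtype.val (B.sum_repr ⟨x, hx⟩)
      simp only [Fin.sum_univ_two] at this
      exact ⟨_, _, by simpa using this.symm⟩
    · rintro ⟨m, n, rfl⟩
      have h1 := S.add_mem (S.smul_mem m (B 0).2) (S.smul_mem n (B 1).2)
      exact (by simpa using h1 : (m * B 0 + n * B 1 : ℂ) ∈ S)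

/-- Every lattice has a basis `(ω, ωτ)` with `τ` in the standard fundamental domain. -/
lemma IsLattice.exists_latticePair {Γ : AddSubgroup ℂ} (h : IsLattice Γ) :
    ∃ (ω τ : ℂ) (hω : ω ≠ 0) (hτ : 0 < τ.im), 1 ≤ ‖τ‖ ∧ |τ.re| ≤ 1 / 2 ∧
      Γ = (latticePair ω τ hω hτ).lattice.toAddSubgroup := by
  obtain ⟨a, b, hli, hmem⟩ := h.exists_basis
  have ha : a ≠ 0 := hli.ne_zero 0
  have him : (b / a).im ≠ 0 := by
    intro h0
    have h1 : b / a = ((b / a).re : ℂ) := by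
      apply Complex.ext <;> simp [h0]
    have h2 := (LinearIndependent.pair_iff.1 hli) (-(b / a).re) 1 (by
      rw [real_smul, one_smul, ofReal_neg, ← h1]
      field_simp
      ring)
    exact one_ne_zero h2.2
  obtain ⟨z, hz⟩ : ∃ z : UpperHalfPlane, ∀ x, x ∈ Γ ↔ ∃ m n : ℤ, x = m * a + n * (a * z) := by
    -- Replacing b by −b corrects the orientation.
    rcases him.lt_or_gt with h0 | h0
    · refine ⟨⟨-(b / a), by simpa using h0⟩, fun x ↦ (hmem x).trans ?_⟩
      have hab : a * -(b / a) = -b := by field_simp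
      simp only [hab]
      constructor
      · rintro ⟨m, n, rfl⟩
        exact ⟨m, -n, by push_cast; ring⟩
      · rintro ⟨m, n, rfl⟩
        exact ⟨m, -n, by push_cast; ring⟩
    · refine ⟨⟨b / a, h0⟩, fun x ↦ (hmem x).trans ?_⟩
      have hab : a * (b / a) = b := by field_simp
      simp only [hab]
  obtain ⟨g, hg⟩ := ModularGroup.exists_smul_mem_fd z
  set τ : UpperHalfPlane := g • z with hτ
  have hdet := g.det_coe
  rw [Matrix.det_fin_two] at hdet
  have hgz : (τ : ℂ) = ((g 0 0 : ℤ) * z + (g 0 1 : ℤ)) / ((g 1 0 : ℤ) * z + (g 1 1 : ℤ)) := by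
    rw [hτ, UpperHalfPlane.specialLinearGroup_apply]
    simp
  generalize g 0 0 = p at hdet hgz
  generalize g 0 1 = q at hdet hgz
  generalize g 1 0 = r at hdet hgz
  generalize g 1 1 = s at hdet hgz
  have hden : (r * z + s : ℂ) ≠ 0 := by
    intro h0
    rw [h0, div_zero] at hgz
    exact τ.ne_zero hgz
  have hmul : a * (r * z + s) * τ = a * (p * z + q) := by
    rw [hgz]; field_simp
  have hdet' : (p * s - q * r : ℂ) = 1 := by exact_mod_cast hdet
  have hτim : 0 < (τ : ℂ).im := τ.im_pos
  refine ⟨a * (r * z + s), τ, mul_ne_zero ha hden, hτim, ?_, hg.2, ?_⟩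
  · have := hg.1
    rw [normSq_eq_norm_sq] at this
    nlinarith [norm_nonneg (τ : ℂ)]
  · ext x
    rw [hz, Submodule.mem_toAddSubgroup, mem_latticePair, hmul]
    constructor
    · rintro ⟨m, n, rfl⟩
      -- The inverse of the base change matrix, which has determinant 1.
      refine ⟨p * m - q * n, s * n - r * m, ?_⟩
      push_cast
      linear_combination (-(a * m) - a * n * z) * hdet'
    · rintro ⟨m, n, rfl⟩
      exact ⟨m * s + n * q, m * r + n * p, by push_cast; ring⟩

/-! ### Classification of the subgroups of index two. -/

section IndexTwo

variable {ω τ : ℂ} (hω : ω ≠ 0) (hτ : 0 < τ.im)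

lemma mem_subpair₁_iff {m n : ℤ} :
    m * ω + n * (ω * τ) ∈ (subpair₁ hω hτ).lattice ↔ Even n := by
  rw [mem_subpair₁]
  refine ⟨?_, fun h ↦ ⟨m, n, h, rfl⟩⟩
  rintro ⟨m', n', h, e⟩
  obtain ⟨rfl, rfl⟩ := coeff_unique hω hτ e
  exact h

lemma mem_subpair₂_iff {m n : ℤ} :
    m * ω + n * (ω * τ) ∈ (subpair₂ hω hτ).lattice ↔ Even m := by
  rw [mem_subpair₂]
  refine ⟨?_, fun h ↦ ⟨m, n, h, rfl⟩⟩
  rintro ⟨m', n', h, e⟩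
  obtain ⟨rfl, rfl⟩ := coeff_unique hω hτ e
  exact h

lemma mem_subpair₃_iff {m n : ℤ} :
    m * ω + n * (ω * τ) ∈ (subpair₃ hω hτ).lattice ↔ Even (m + n) := by
  rw [mem_subpair₃]
  refine ⟨?_, fun h ↦ ⟨m, n, h, rfl⟩⟩
  rintro ⟨m', n', h, e⟩
  obtain ⟨rfl, rfl⟩ := coeff_unique hω hτ e
  exact h

lemma isIndexTwo_subpair₁ : IsIndexTwo (subpair₁ hω hτ).lattice.toAddSubgroup
    (latticePair ω τ hω hτ).lattice.toAddSubgroup := by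
  constructor
  · intro x hx
    obtain ⟨m, n, -, rfl⟩ := (mem_subpair₁ hω hτ).1 hx
    exact (mem_latticePair hω hτ).2 ⟨m, n, rfl⟩
  · rw [AddSubgroup.relIndex_eq_two_iff]
    refine ⟨ω * τ, (mem_latticePair hω hτ).2 ⟨0, 1, by simp⟩, fun b hb ↦ ?_⟩
    obtain ⟨m, n, rfl⟩ := (mem_latticePair hω hτ).1 hb
    rw [show m * ω + n * (ω * τ) + ω * τ = m * ω + (n + 1 : ℤ) * (ω * τ) by push_cast; ring,
      Submodule.mem_toAddSubgroup, Submodule.mem_toAddSubgroup, mem_subpair₁_iff, mem_subpair₁_iff,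
      Int.even_add_one, xor_not_left]

lemma isIndexTwo_subpair₂ : IsIndexTwo (subpair₂ hω hτ).lattice.toAddSubgroup
    (latticePair ω τ hω hτ).lattice.toAddSubgroup := by
  constructor
  · intro x hx
    obtain ⟨m, n, -, rfl⟩ := (mem_subpair₂ hω hτ).1 hx
    exact (mem_latticePair hω hτ).2 ⟨m, n, rfl⟩
  · rw [AddSubgroup.relIndex_eq_two_iff]
    refine ⟨ω, (mem_latticePair hω hτ).2 ⟨1, 0, by simp⟩, fun b hb ↦ ?_⟩
    obtain ⟨m, n, rfl⟩ := (mem_latticePair hω hτ).1 hb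
    rw [show m * ω + n * (ω * τ) + ω = (m + 1 : ℤ) * ω + n * (ω * τ) by push_cast; ring,
      Submodule.mem_toAddSubgroup, Submodule.mem_toAddSubgroup, mem_subpair₂_iff, mem_subpair₂_iff,
      Int.even_add_one, xor_not_left]

lemma isIndexTwo_subpair₃ : IsIndexTwo (subpair₃ hω hτ).lattice.toAddSubgroup
    (latticePair ω τ hω hτ).lattice.toAddSubgroup := by
  constructor
  · intro x hx
    obtain ⟨m, n, -, rfl⟩ := (mem_subpair₃ hω hτ).1 hx
    exact (mem_latticePair hω hτ).2 ⟨m, n, rfl⟩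
  · rw [AddSubgroup.relIndex_eq_two_iff]
    refine ⟨ω, (mem_latticePair hω hτ).2 ⟨1, 0, by simp⟩, fun b hb ↦ ?_⟩
    obtain ⟨m, n, rfl⟩ := (mem_latticePair hω hτ).1 hb
    rw [show m * ω + n * (ω * τ) + ω = (m + 1 : ℤ) * ω + n * (ω * τ) by push_cast; ring,
      Submodule.mem_toAddSubgroup, Submodule.mem_toAddSubgroup, mem_subpair₃_iff, mem_subpair₃_iff,
      add_right_comm, Int.even_add_one, xor_not_left]

lemma IsIndexTwo.add_mem_iff {G Γ : AddSubgroup ℂ} (h : IsIndexTwo G Γ) {x y : ℂ} (hx : x ∈ Γ)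
    (hy : y ∈ Γ) : x + y ∈ G ↔ (x ∈ G ↔ y ∈ G) :=
  AddSubgroup.add_mem_iff_of_index_two (H := G.addSubgroupOf Γ) h.2 (a := ⟨x, hx⟩) (b := ⟨y, hy⟩)

lemma IsIndexTwo.int_mul_mem_iff {G Γ : AddSubgroup ℂ} (h : IsIndexTwo G Γ) {x : ℂ} (hx : x ∈ Γ)
    (m : ℤ) : m * x ∈ G ↔ Even m ∨ x ∈ G := by
  have hm : ∀ k : ℤ, k * x ∈ Γ := fun k ↦ by simpa using Γ.zsmul_mem hx k
  have heven : ∀ k : ℤ, ((2 * k : ℤ) : ℂ) * x ∈ G := fun k ↦ by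
    rw [show ((2 * k : ℤ) : ℂ) * x = k * x + k * x by push_cast; ring, h.add_mem_iff (hm k) (hm k)]
  rcases Int.even_or_odd' m with ⟨k, rfl | rfl⟩
  · exact iff_of_true (heven k) (.inl (by simp))
  · have h1 : ¬ Even (2 * k + 1) := by simp
    rw [show ((2 * k + 1 : ℤ) : ℂ) * x = ((2 * k : ℤ) : ℂ) * x + x by push_cast; ring,
      h.add_mem_iff (hm _) hx]
    simp only [heven k, h1, true_iff, false_or]

/-- The quotient has order two, so membership of mω + nωτ is decided by the parities of m, n and by
whether ω and ωτ lie in G. If both do, the index is 1; the other three cases are the three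
sublattices. -/
lemma IsIndexTwo.eq_subpair {G : AddSubgroup ℂ}
    (h : IsIndexTwo G (latticePair ω τ hω hτ).lattice.toAddSubgroup) :
    G = (subpair₁ hω hτ).lattice.toAddSubgroup ∨ G = (subpair₂ hω hτ).lattice.toAddSubgroup ∨
      G = (subpair₃ hω hτ).lattice.toAddSubgroup := by
  have m1 : ω ∈ (latticePair ω τ hω hτ).lattice.toAddSubgroup :=
    (mem_latticePair hω hτ).2 ⟨1, 0, by simp⟩
  have m2 : ω * τ ∈ (latticePair ω τ hω hτ).lattice.toAddSubgroup :=
    (mem_latticePair hω hτ).2 ⟨0, 1, by simp⟩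
  have hG : ∀ m n : ℤ, m * ω + n * (ω * τ) ∈ G ↔ ((Even m ∨ ω ∈ G) ↔ (Even n ∨ ω * τ ∈ G)) := by
    intro m n
    rw [h.add_mem_iff (by simpa using AddSubgroup.zsmul_mem _ m1 m)
      (by simpa using AddSubgroup.zsmul_mem _ m2 n), h.int_mul_mem_iff m1, h.int_mul_mem_iff m2]
  have hle : ∀ H : AddSubgroup ℂ, H ≤ (latticePair ω τ hω hτ).lattice.toAddSubgroup →
      (∀ m n : ℤ, m * ω + n * (ω * τ) ∈ G ↔ m * ω + n * (ω * τ) ∈ H) → G = H := by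
    intro H hH he
    ext x
    by_cases hx : x ∈ (latticePair ω τ hω hτ).lattice.toAddSubgroup
    · obtain ⟨m, n, rfl⟩ := (mem_latticePair hω hτ).1 hx
      exact he m n
    · exact ⟨fun h' ↦ absurd (h.1 h') hx, fun h' ↦ absurd (hH h') hx⟩
  by_cases h1 : ω ∈ G <;> by_cases h2 : ω * τ ∈ G
  · exfalso
    have h3 := AddSubgroup.relIndex_eq_one.2 (fun x hx ↦ by
      obtain ⟨m, n, rfl⟩ := (mem_latticePair hω hτ).1 hx
      rw [hG]
      simp [h1, h2] : (latticePair ω τ hω hτ).lattice.toAddSubgroup ≤ G)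
    have := h.2
    omega
  · refine .inl (hle _ (isIndexTwo_subpair₁ hω hτ).1 fun m n ↦ ?_)
    rw [hG, Submodule.mem_toAddSubgroup, mem_subpair₁_iff]
    simp [h1, h2]
  · refine .inr (.inl (hle _ (isIndexTwo_subpair₂ hω hτ).1 fun m n ↦ ?_))
    rw [hG, Submodule.mem_toAddSubgroup, mem_subpair₂_iff]
    simp [h1, h2]
  · refine .inr (.inr (hle _ (isIndexTwo_subpair₃ hω hτ).1 fun m n ↦ ?_))
    rw [hG, Submodule.mem_toAddSubgroup, mem_subpair₃_iff, Int.even_add]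
    simp [h1, h2]

lemma isOptimal_iff {G : AddSubgroup ℂ}
    (h : IsIndexTwo G (latticePair ω τ hω hτ).lattice.toAddSubgroup) :
    IsOptimal G (latticePair ω τ hω hτ).lattice.toAddSubgroup ↔
      ‖discr G‖ ≤ ‖discr (subpair₁ hω hτ).lattice.toAddSubgroup‖ ∧
      ‖discr G‖ ≤ ‖discr (subpair₂ hω hτ).lattice.toAddSubgroup‖ ∧
      ‖discr G‖ ≤ ‖discr (subpair₃ hω hτ).lattice.toAddSubgroup‖ := by
  constructor
  · rintro ⟨-, H⟩
    exact ⟨H _ (isIndexTwo_subpair₁ hω hτ), H _ (isIndexTwo_subpair₂ hω hτ),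
      H _ (isIndexTwo_subpair₃ hω hτ)⟩
  · rintro ⟨H1, H2, H3⟩
    refine ⟨h, fun G' hG' ↦ ?_⟩
    rcases hG'.eq_subpair with rfl | rfl | rfl
    exacts [H1, H2, H3]

end IndexTwo

/-! ### Ordering of the three discriminants. -/

section Comparison

variable {ω τ : ℂ} (hω : ω ≠ 0) (hτ : 0 < τ.im)

lemma norm_discr_subpair₁ : ‖discr (subpair₁ hω hτ).lattice.toAddSubgroup‖ =
    Real.pi ^ 12 * (‖ω‖ ^ 12)⁻¹ * (2 ^ 12 * ‖ModularForm.eta (2 * τ)‖ ^ 24) := by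
  rw [subpair₁, norm_discr_eq _ (τ := 2 * τ) (by simpa using hτ) rfl]
  simp only [latticePair]
  ring

lemma norm_discr_subpair₂ : ‖discr (subpair₂ hω hτ).lattice.toAddSubgroup‖ =
    Real.pi ^ 12 * (‖ω‖ ^ 12)⁻¹ * ‖ModularForm.eta (τ / 2)‖ ^ 24 := by
  rw [subpair₂, norm_discr_eq _ (τ := τ / 2) (by simpa using hτ) rfl]
  simp only [latticePair, norm_mul, mul_pow, mul_inv, norm_ofNat]
  ring

lemma norm_discr_subpair₃ : ‖discr (subpair₃ hω hτ).lattice.toAddSubgroup‖ =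
    Real.pi ^ 12 * (‖ω‖ ^ 12)⁻¹ * ‖ModularForm.eta ((τ + 1) / 2)‖ ^ 24 := by
  rw [subpair₃, norm_discr_eq _ (τ := (τ + 1) / 2) (by simpa using hτ) rfl]
  simp only [latticePair, norm_mul, mul_pow, mul_inv, norm_ofNat]
  ring

lemma scale_pos {ω : ℂ} (hω : ω ≠ 0) : 0 < Real.pi ^ 12 * (‖ω‖ ^ 12)⁻¹ :=
  mul_pos (pow_pos Real.pi_pos _) (inv_pos.2 (pow_pos (norm_pos_iff.2 hω) _))

lemma norm_discr_subpair₁_le_subpair₂ (h1 : 1 ≤ ‖τ‖) (hre : |τ.re| ≤ 1 / 2) :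
    ‖discr (subpair₁ hω hτ).lattice.toAddSubgroup‖ ≤
      ‖discr (subpair₂ hω hτ).lattice.toAddSubgroup‖ := by
  rw [norm_discr_subpair₁, norm_discr_subpair₂]
  refine mul_le_mul_of_nonneg_left ?_ (scale_pos hω).le
  rcases h1.eq_or_lt with h | h
  · exact (norm_eta_eq_of_norm_eq_one hτ h.symm).le
  · exact (norm_eta_lt_of_one_lt_norm hτ hre h).le

lemma norm_discr_subpair₂_le_subpair₁_iff (h1 : 1 ≤ ‖τ‖) (hre : |τ.re| ≤ 1 / 2) :
    ‖discr (subpair₂ hω hτ).lattice.toAddSubgroup‖ ≤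
      ‖discr (subpair₁ hω hτ).lattice.toAddSubgroup‖ ↔ ‖τ‖ = 1 := by
  rw [norm_discr_subpair₁, norm_discr_subpair₂, mul_le_mul_iff_right₀ (scale_pos hω)]
  rcases h1.eq_or_lt with h | h
  · exact iff_of_true (norm_eta_eq_of_norm_eq_one hτ h.symm).ge h.symm
  · exact iff_of_false (norm_eta_lt_of_one_lt_norm hτ hre h).not_ge h.ne'

lemma three_le_four_mul_im_sq {τ : ℂ} (h1 : 1 ≤ ‖τ‖) (hre : |τ.re| ≤ 1 / 2) :
    3 ≤ 4 * τ.im ^ 2 := by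
  have h2 : 1 ≤ ‖τ‖ ^ 2 := one_le_pow₀ h1
  rw [← normSq_eq_norm_sq, normSq_apply] at h2
  nlinarith [sq_abs τ.re, abs_nonneg τ.re]

lemma norm_discr_subpair₂_le_subpair₃ (h1 : 1 ≤ ‖τ‖) (hre : |τ.re| ≤ 1 / 2) :
    ‖discr (subpair₂ hω hτ).lattice.toAddSubgroup‖ ≤
      ‖discr (subpair₃ hω hτ).lattice.toAddSubgroup‖ := by
  rw [norm_discr_subpair₂, norm_discr_subpair₃]
  exact mul_le_mul_of_nonneg_left
    (norm_eta_half_le hτ (three_le_four_mul_im_sq h1 hre) hre).1 (scale_pos hω).le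

lemma norm_discr_subpair₃_le_subpair₂_iff (h1 : 1 ≤ ‖τ‖) (hre : |τ.re| ≤ 1 / 2) :
    ‖discr (subpair₃ hω hτ).lattice.toAddSubgroup‖ ≤
      ‖discr (subpair₂ hω hτ).lattice.toAddSubgroup‖ ↔ |τ.re| = 1 / 2 := by
  rw [norm_discr_subpair₂, norm_discr_subpair₃, mul_le_mul_iff_right₀ (scale_pos hω)]
  have him := three_le_four_mul_im_sq h1 hre
  rcases hre.eq_or_lt with h | h
  · exact iff_of_true (norm_eta_half_add_eq hτ him h).le h
  · exact iff_of_false ((norm_eta_half_le hτ him hre).2 h).not_ge h.ne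

end Comparison

/-! ### Shortest vectors. -/

section MinimalVectors

variable {ω τ : ℂ} (hω : ω ≠ 0) (hτ : 0 < τ.im)

lemma sq_norm_int_comb (ω τ : ℂ) (m n : ℤ) : ‖(m * ω + n * (ω * τ) : ℂ)‖ ^ 2 =
    ‖ω‖ ^ 2 * (m ^ 2 + 2 * m * n * τ.re + n ^ 2 * ‖τ‖ ^ 2) := by
  rw [show (m * ω + n * (ω * τ) : ℂ) = ω * (m + n * τ) by ring, norm_mul, mul_pow,
    ← normSq_eq_norm_sq (m + n * τ), ← normSq_eq_norm_sq τ, normSq_apply, normSq_apply]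
  congr 1
  simp
  ring

/-- The form |m|² − |m||n| + |n|² is positive definite and takes integer values. -/
lemma one_le_sq_sub_add_sq {m n : ℤ} (h : m ≠ 0 ∨ n ≠ 0) :
    (1 : ℝ) ≤ m ^ 2 - |(m * n : ℝ)| + n ^ 2 := by
  have : 1 ≤ m ^ 2 - |m * n| + n ^ 2 := by
    by_contra! hlt
    have h0 : m ^ 2 - |m * n| + n ^ 2 ≤ 0 := by omega
    have h1 := sq_abs m
    have h2 := sq_abs n
    rw [abs_mul] at h0
    have hm := abs_nonneg m
    have hn := abs_nonneg n
    have h3 : |m| ^ 2 + |n| ^ 2 ≤ 0 := by nlinarith [sq_nonneg (|m| - |n|)]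
    have hm0 : m = 0 := by
      rw [← abs_eq_zero]; nlinarith
    have hn0 : n = 0 := by
      rw [← abs_eq_zero]; nlinarith
    simp_all
  exact_mod_cast this

/-- Lower bound for the norm form of a reduced basis. -/
lemma sub_abs_add_le (τ : ℂ) (m n : ℤ) :
    (m : ℝ) ^ 2 - |(m * n : ℝ)| + n ^ 2 + (n ^ 2 * (‖τ‖ ^ 2 - 1) + |(m * n : ℝ)| * (1 - 2 * |τ.re|))
      ≤ m ^ 2 + 2 * m * n * τ.re + n ^ 2 * ‖τ‖ ^ 2 := by
  have h := neg_abs_le ((m * n : ℝ) * τ.re)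
  rw [abs_mul] at h
  linarith

lemma norm_le_of_mem (h1 : 1 ≤ ‖τ‖) (hre : |τ.re| ≤ 1 / 2) {x : ℂ}
    (hx : x ∈ (latticePair ω τ hω hτ).lattice) (hx0 : x ≠ 0) : ‖ω‖ ≤ ‖x‖ := by
  obtain ⟨m, n, rfl⟩ := (mem_latticePair hω hτ).1 hx
  have hmn : m ≠ 0 ∨ n ≠ 0 := by
    by_contra! h
    simp [h.1, h.2] at hx0
  have h2 := one_le_sq_sub_add_sq hmn
  have h3 := sub_abs_add_le τ m n
  have h4 : 0 ≤ (n : ℝ) ^ 2 * (‖τ‖ ^ 2 - 1) :=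
    mul_nonneg (sq_nonneg _) (sub_nonneg.2 (one_le_pow₀ h1))
  have h5 : 0 ≤ |(m * n : ℝ)| * (1 - 2 * |τ.re|) := mul_nonneg (abs_nonneg _) (by linarith)
  refine le_of_sq_le_sq ?_ (norm_nonneg _)
  rw [sq_norm_int_comb]
  exact le_mul_of_one_le_right (sq_nonneg _) (by linarith)

lemma sInf_norm_latticePair (h1 : 1 ≤ ‖τ‖) (hre : |τ.re| ≤ 1 / 2) :
    sInf ((fun w : ℂ => ‖w‖) ''
      (((latticePair ω τ hω hτ).lattice.toAddSubgroup : Set ℂ) \ {0})) = ‖ω‖ := by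
  refine IsLeast.csInf_eq ⟨⟨ω, ⟨(mem_latticePair hω hτ).2 ⟨1, 0, by simp⟩, hω⟩, rfl⟩, ?_⟩
  rintro _ ⟨x, ⟨hx, hx0⟩, rfl⟩
  exact norm_le_of_mem hω hτ h1 hre hx hx0

/-- The norm form equals 1, and its integral part is already at least 1, so both nonnegative
correction terms in `sub_abs_add_le` vanish. -/
lemma int_comb_eq_of_norm_eq (hω : ω ≠ 0) (h1 : 1 ≤ ‖τ‖) (hre : |τ.re| ≤ 1 / 2) {m n : ℤ}
    (h : ‖(m * ω + n * (ω * τ) : ℂ)‖ = ‖ω‖) :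
    (m : ℝ) ^ 2 - |(m * n : ℝ)| + n ^ 2 = 1 ∧ (n ≠ 0 → ‖τ‖ = 1) ∧
      (m ≠ 0 → n ≠ 0 → |τ.re| = 1 / 2) := by
  have hpos : 0 < ‖ω‖ ^ 2 := pow_pos (norm_pos_iff.2 hω) 2
  have hq : (m ^ 2 + 2 * m * n * τ.re + n ^ 2 * ‖τ‖ ^ 2 : ℝ) = 1 := by
    have := sq_norm_int_comb ω τ m n
    rw [h] at this
    exact mul_left_cancel₀ hpos.ne' (by linarith)
  have hmn : m ≠ 0 ∨ n ≠ 0 := by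
    by_contra! h
    simp [h.1, h.2] at hq
  have h2 := one_le_sq_sub_add_sq hmn
  have h3 := sub_abs_add_le τ m n
  have h4 : 0 ≤ (n : ℝ) ^ 2 * (‖τ‖ ^ 2 - 1) :=
    mul_nonneg (sq_nonneg _) (sub_nonneg.2 (one_le_pow₀ h1))
  have h5 : 0 ≤ |(m * n : ℝ)| * (1 - 2 * |τ.re|) := mul_nonneg (abs_nonneg _) (by linarith)
  refine ⟨by linarith, fun hn ↦ ?_, fun hm hn ↦ ?_⟩
  · have h6 : (n : ℝ) ^ 2 * (‖τ‖ ^ 2 - 1) = 0 := by linarith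
    have h7 := (mul_eq_zero.1 h6).resolve_left (pow_ne_zero 2 (by exact_mod_cast hn))
    nlinarith
  · have h6 : |(m * n : ℝ)| * (1 - 2 * |τ.re|) = 0 := by linarith
    have h7 := (mul_eq_zero.1 h6).resolve_left
      (abs_ne_zero.2 (mul_ne_zero (by exact_mod_cast hm) (by exact_mod_cast hn)))
    linarith

lemma exists_minimal_mem_subpair₂_iff (h1 : 1 ≤ ‖τ‖) (hre : |τ.re| ≤ 1 / 2) :
    (∃ x ∈ (latticePair ω τ hω hτ).lattice.toAddSubgroup,
      x ∈ (subpair₂ hω hτ).lattice.toAddSubgroup ∧ ‖x‖ = ‖ω‖) ↔ ‖τ‖ = 1 := by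
  constructor
  · rintro ⟨_, -, hx, hn⟩
    obtain ⟨m, n, hm, rfl⟩ := (mem_subpair₂ hω hτ).1 hx
    obtain ⟨hq, h2, -⟩ := int_comb_eq_of_norm_eq hω h1 hre hn
    refine h2 ?_
    rintro rfl
    obtain ⟨k, rfl⟩ := hm
    have hk : (k + k : ℝ) = 1 ∨ (k + k : ℝ) = -1 := by simpa using hq
    have hk' : k + k = 1 ∨ k + k = -1 := by exact_mod_cast hk
    omega
  · intro h
    exact ⟨ω * τ, (mem_latticePair hω hτ).2 ⟨0, 1, by simp⟩,
      (mem_subpair₂ hω hτ).2 ⟨0, 1, by simp, by simp⟩, by rw [norm_mul, h, mul_one]⟩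

lemma exists_minimal_mem_subpair₃_iff (h1 : 1 ≤ ‖τ‖) (hre : |τ.re| ≤ 1 / 2) :
    (∃ x ∈ (latticePair ω τ hω hτ).lattice.toAddSubgroup,
      x ∈ (subpair₃ hω hτ).lattice.toAddSubgroup ∧ ‖x‖ = ‖ω‖) ↔ ‖τ‖ = 1 ∧ |τ.re| = 1 / 2 := by
  constructor
  · rintro ⟨_, -, hx, hn⟩
    obtain ⟨m, n, hmn, rfl⟩ := (mem_subpair₃ hω hτ).1 hx
    obtain ⟨hq, h2, h3⟩ := int_comb_eq_of_norm_eq hω h1 hre hn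
    have hq' : m ^ 2 - |m * n| + n ^ 2 = 1 := by exact_mod_cast hq
    have hm0 : m ≠ 0 := by
      rintro rfl
      obtain ⟨k, hk⟩ := hmn
      obtain rfl : n = k + k := by omega
      have h4 : 4 * k ^ 2 = 1 := by linear_combination (by simpa using hq' : (k + k) ^ 2 = 1)
      omega
    have hn0 : n ≠ 0 := by
      rintro rfl
      obtain ⟨k, hk⟩ := hmn
      obtain rfl : m = k + k := by omega
      have h4 : 4 * k ^ 2 = 1 := by linear_combination (by simpa using hq' : (k + k) ^ 2 = 1)
      omega
    exact ⟨h2 hn0, h3 hm0 hn0⟩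
  · rintro ⟨h, hr⟩
    -- The witness is ωτ ± ω, with the sign opposite to that of Re τ.
    have key : ∀ m : ℤ, Odd m → (m : ℝ) ^ 2 + 2 * m * τ.re = 0 →
        ∃ x ∈ (latticePair ω τ hω hτ).lattice.toAddSubgroup,
          x ∈ (subpair₃ hω hτ).lattice.toAddSubgroup ∧ ‖x‖ = ‖ω‖ := by
      intro m hm h0
      refine ⟨m * ω + (1 : ℤ) * (ω * τ), (mem_latticePair hω hτ).2 ⟨m, 1, rfl⟩,
        (mem_subpair₃ hω hτ).2 ⟨m, 1, hm.add_one, rfl⟩, ?_⟩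
      rw [← pow_left_inj₀ (norm_nonneg _) (norm_nonneg _) two_ne_zero, sq_norm_int_comb, h]
      push_cast
      linear_combination ‖ω‖ ^ 2 * h0
    rcases (abs_eq (by norm_num)).1 hr with h0 | h0
    · exact key (-1) (by decide) (by rw [h0]; norm_num)
    · exact key 1 (by decide) (by rw [h0]; norm_num)

end MinimalVectors

/-! ### Roots of the cubic and the final assembly. -/

lemma pair_eq_pair {a b c d : ℂ} (h : ({a, b} : Multiset ℂ) = {c, d}) :
    a = c ∧ b = d ∨ a = d ∧ b = c := by
  rw [Multiset.insert_eq_cons, Multiset.insert_eq_cons, Multiset.cons_eq_cons] at h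
  rcases h with ⟨rfl, h⟩ | ⟨-, cs, h1, h2⟩
  · exact .inl ⟨rfl, Multiset.singleton_inj.1 h⟩
  · exact .inr ⟨((Multiset.singleton_eq_cons_iff _).1 h2).1.symm,
      ((Multiset.singleton_eq_cons_iff _).1 h1).1⟩

/-- A symmetric condition on two roots does not depend on their numbering. -/
lemma le_min_iff_of_pair_eq {e e₂ e₃ a b : ℂ} (h : ({e₂, e₃} : Multiset ℂ) = {a, b}) :
    ‖e₂ - e₃‖ ≤ min ‖e - e₂‖ ‖e - e₃‖ ↔ ‖a - b‖ ≤ ‖e - a‖ ∧ ‖a - b‖ ≤ ‖e - b‖ := by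
  rcases pair_eq_pair h with ⟨rfl, rfl⟩ | ⟨rfl, rfl⟩
  · exact le_min_iff
  · rw [le_min_iff, norm_sub_rev e₃ e₂, and_comm]

lemma le_iff_of_sq_eq_mul_pow {K a b x y : ℝ} (hK : 0 < K) (ha : 0 ≤ a) (hb : 0 ≤ b) (hx : 0 ≤ x)
    (hy : 0 ≤ y) (h1 : a ^ 2 = K * x ^ 6) (h2 : b ^ 2 = K * y ^ 6) : a ≤ b ↔ x ≤ y := by
  rw [← pow_le_pow_iff_left₀ ha hb two_ne_zero, h1, h2, mul_le_mul_iff_right₀ hK,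
    pow_le_pow_iff_left₀ hx hy (by norm_num)]

lemma wp_half_eq (L : PeriodPair) {w x v : ℂ} (hv : v ∈ L.lattice) (h : w / 2 = x + v) :
    wp L.lattice.toAddSubgroup (w / 2) = L.weierstrassP x := by
  rw [wp_lattice, h]
  exact L.weierstrassP_add_coe x ⟨v, hv⟩

/-- The criterion for optimality in terms of the roots of the cubic. -/
lemma isOptimal_iff_roots {ω τ : ℂ} (hω : ω ≠ 0) (hτ : 0 < τ.im) {G : AddSubgroup ℂ}
    (hG : IsIndexTwo G (latticePair ω τ hω hτ).lattice.toAddSubgroup) {w e₁ e₂ e₃ : ℂ}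
    (hw : w ∈ G) (hw2 : ¬ ∃ v ∈ (latticePair ω τ hω hτ).lattice.toAddSubgroup, w = 2 * v)
    (hroots : (cubic (latticePair ω τ hω hτ).lattice.toAddSubgroup).roots = {e₁, e₂, e₃})
    (he₁ : e₁ = wp (latticePair ω τ hω hτ).lattice.toAddSubgroup (w / 2)) :
    IsOptimal G (latticePair ω τ hω hτ).lattice.toAddSubgroup ↔
      ‖e₂ - e₃‖ ≤ min ‖e₁ - e₂‖ ‖e₁ - e₃‖ := by
  have hr := roots_cubic_latticePair hω hτ _ _ _ rfl rfl rfl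
  obtain ⟨K, hK, k₁, k₂, k₃⟩ := norm_discr_subpair_sq hω hτ _ _ _ rfl rfl rfl
  set E₁ := (latticePair ω τ hω hτ).weierstrassP (ω / 2) with hE₁
  set E₂ := (latticePair ω τ hω hτ).weierstrassP (ω * τ / 2) with hE₂
  set E₃ := (latticePair ω τ hω hτ).weierstrassP ((ω + ω * τ) / 2) with hE₃
  rw [hr] at hroots
  have hmem : ∀ m n : ℤ, m * ω + n * (ω * τ) ∈ (latticePair ω τ hω hτ).lattice := fun m n ↦
    (mem_latticePair hω hτ).2 ⟨m, n, rfl⟩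
  have comm : ∀ a b c : ℂ, ({a, b, c} : Multiset ℂ) = {b, a, c} := fun a b c ↦
    Multiset.cons_swap a b {c}
  have comm' : ∀ a b c : ℂ, ({a, b, c} : Multiset ℂ) = {c, a, b} := fun a b c ↦ by
    rw [comm c a b, Multiset.insert_eq_cons, Multiset.insert_eq_cons a, Multiset.pair_comm]
  have le_iff : ∀ {A B x y : ℂ}, ‖A‖ ^ 2 = K * ‖x‖ ^ 6 → ‖B‖ ^ 2 = K * ‖y‖ ^ 6 →
      (‖A‖ ≤ ‖B‖ ↔ ‖x‖ ≤ ‖y‖) := fun h h' ↦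
    le_iff_of_sq_eq_mul_pow hK (norm_nonneg _) (norm_nonneg _) (norm_nonneg _) (norm_nonneg _) h h'
  rw [isOptimal_iff hω hτ hG]
  rcases hG.eq_subpair with rfl | rfl | rfl
  · obtain ⟨m, n, hn, rfl⟩ := (mem_subpair₁ hω hτ).1 hw
    obtain ⟨k, rfl⟩ := hn.two_dvd
    rcases Int.even_or_odd' m with ⟨j, rfl | rfl⟩
    -- Both coefficients even would put w in 2Γ. Otherwise w/2 is congruent to ω/2 modulo Γ, so e₁ =
    -- E₁, and cancelling it leaves {E₂, E₃} = {e₂, e₃} as multisets.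
    · exact absurd ⟨_, hmem j k, by push_cast; ring⟩ hw2
    rw [wp_half_eq _ (x := ω / 2) (hmem j k) (by push_cast; ring), ← hE₁] at he₁
    subst he₁
    have hp := (Multiset.cons_inj_right _).1 hroots
    rw [le_min_iff_of_pair_eq hp.symm, le_iff k₁ k₁, le_iff k₁ k₂, le_iff k₁ k₃]
    tauto
  · obtain ⟨m, n, hm, rfl⟩ := (mem_subpair₂ hω hτ).1 hw
    obtain ⟨k, rfl⟩ := hm.two_dvd
    rcases Int.even_or_odd' n with ⟨j, rfl | rfl⟩
    · exact absurd ⟨_, hmem k j, by push_cast; ring⟩ hw2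
    rw [wp_half_eq _ (x := ω * τ / 2) (hmem k j) (by push_cast; ring), ← hE₂] at he₁
    subst he₁
    rw [comm] at hroots
    have hp := (Multiset.cons_inj_right _).1 hroots
    rw [le_min_iff_of_pair_eq hp.symm, le_iff k₂ k₁, le_iff k₂ k₂, le_iff k₂ k₃,
      norm_sub_rev E₂ E₁]
    tauto
  · obtain ⟨m, n, ⟨k, hk⟩, rfl⟩ := (mem_subpair₃ hω hτ).1 hw
    obtain rfl : n = k + k - m := by omega
    rcases Int.even_or_odd' m with ⟨j, rfl | rfl⟩
    · exact absurd ⟨_, hmem j (k - j), by push_cast; ring⟩ hw2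
    rw [wp_half_eq _ (x := (ω + ω * τ) / 2) (hmem j (k - j - 1)) (by push_cast; ring), ← hE₃] at he₁
    subst he₁
    rw [comm'] at hroots
    have hp := (Multiset.cons_inj_right _).1 hroots
    rw [le_min_iff_of_pair_eq hp.symm, le_iff k₃ k₁, le_iff k₃ k₂, le_iff k₃ k₃,
      norm_sub_rev E₃ E₁, norm_sub_rev E₃ E₂]
    tauto

end LandenLattice

theorem propositionp33 (Γ Γ' : AddSubgroup ℂ)
    (hΓ : LandenLattice.IsLattice Γ) (hΓ' : LandenLattice.IsIndexTwo Γ' Γ) :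
    (∀ ω e₁ e₂ e₃ : ℂ, ω ∈ Γ' → (¬ ∃ w ∈ Γ, ω = 2 * w) →
      (LandenLattice.cubic Γ).roots = {e₁, e₂, e₃} →
      e₁ = LandenLattice.wp Γ (ω / 2) →
      (LandenLattice.IsOptimal Γ' Γ ↔ ‖e₂ - e₃‖ ≤ min ‖e₁ - e₂‖ ‖e₁ - e₃‖)) ∧
    (LandenLattice.IsOptimal Γ' Γ ↔
      ∃ ω ∈ Γ, ω ∈ Γ' ∧ ‖ω‖ = sInf ((fun w : ℂ => ‖w‖) '' ((Γ : Set ℂ) \ {0}))) := by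
  obtain ⟨ω, τ, hω, hτ, h1, hre, rfl⟩ := hΓ.exists_latticePair
  have h12 := LandenLattice.norm_discr_subpair₁_le_subpair₂ hω hτ h1 hre
  have h23 := LandenLattice.norm_discr_subpair₂_le_subpair₃ hω hτ h1 hre
  have h21 := LandenLattice.norm_discr_subpair₂_le_subpair₁_iff hω hτ h1 hre
  have h32 := LandenLattice.norm_discr_subpair₃_le_subpair₂_iff hω hτ h1 hre
  refine ⟨?_, ?_⟩
  · exact fun w e₁ e₂ e₃ hw hw2 hroots he₁ ↦ LandenLattice.isOptimal_iff_roots hω hτ hΓ' hw hw2 hroots he₁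
  · rw [LandenLattice.isOptimal_iff hω hτ hΓ', LandenLattice.sInf_norm_latticePair hω hτ h1 hre]
    -- Γ₁ is always optimal and contains ω. For Γ₂ and Γ₃ both sides reduce to the equality cases in
    -- |Δ(Γ₁)| ≤ |Δ(Γ₂)| ≤ |Δ(Γ₃)|.
    rcases hΓ'.eq_subpair with rfl | rfl | rfl
    · exact iff_of_true ⟨le_rfl, h12, h12.trans h23⟩
        ⟨ω, (LandenLattice.mem_latticePair hω hτ).2 ⟨1, 0, by simp⟩,
          (LandenLattice.mem_subpair₁ hω hτ).2 ⟨1, 0, by simp, by simp⟩, rfl⟩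
    · rw [LandenLattice.exists_minimal_mem_subpair₂_iff hω hτ h1 hre, ← h21]
      exact ⟨fun h ↦ h.1, fun h ↦ ⟨h, le_rfl, h23⟩⟩
    · rw [LandenLattice.exists_minimal_mem_subpair₃_iff hω hτ h1 hre, ← h21, ← h32]
      exact ⟨fun h ↦ ⟨h23.trans h.1, h.2.1⟩, fun h ↦ ⟨h.2.trans h.1, h.2, le_rfl⟩⟩
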